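/- For integers $a,b,c,S$ and a positive integer $k$ let $$G(a,b,c;S;k)=\sum_{x,y=0}^{k-1} e^{2\pi i S(ax^2+bxy+cy^2)/k}.$$ Let $p$ be a prime, $n\ge 1$ an integer, $S$ an integer coprime to $p$, and let $a,b,c$ be integers with $$\gcd(a,b,c)=1,\quad a\equiv p^{\alpha}A \pmod{p^n},\quad b\equiv p^{\beta}B\pmod{p^n},\quad c\equiv 0\pmod{p^{\alpha}},$$ where $\alpha,\beta\ge 0$ and $A,B$ are integers with $p\nmid AB$, and $\alpha\le n$ (so that $\alpha=n$ when $p^n\mid a$). Put $\Delta=4ac-b^2$. Let $\left(\frac{\cdot}{p}\right)$ be the Legendre symbol if $p$ is odd, and for odd $m\in\mathbb Z$ let $\left(\frac 2m\right)$ be the Kronecker symbol, i.e. the Jacobi symbol $\left(\frac{2}{|m|}\right)$. (i) Let $p$ be odd and write $\Delta\equiv p^{\delta}D \pmod{p^{n+\alpha}}$ with $0\le\delta\le n+\alpha$ and $D\in\mathbb Z$, $p\nmid D$. Then $$G(a,b,c;S;p^n)=p^{n+\frac{\delta}{2}}\left(\frac{SA}{p}\right)^{\delta}\left(\frac{D}{p}\right)^{n+\alpha+\delta}\left(\frac{-1}{p}\right)^{(n+\alpha)(\delta+1)}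 i^{\left(\frac{p^{\delta}-1}{2}\right)^2}.$$ (ii) Let $p=2$ and $\alpha+1<n$, and write $\Delta\equiv 2^{\delta}D\pmod{2^{n+\alpha+2}}$ with $0\le\delta\le n+\alpha+2$ and $D$ an odd integer. Then $$G(a,b,c;S;2^n)=\begin{cases}2^{\frac{3n+\alpha}{2}}\left(\frac{2}{SA}\right)^{\delta}\left(1+i^{SA}\right)&\text{if }\delta=n+\alpha+2,\\ 0&\text{if }\delta=n+\alpha+1,\\ 2^{n+\frac{\delta}{2}}\left(\frac{2}{SA}\right)^{\delta}\left(\frac{2}{D}\right)^{n+\alpha+\delta} i^{SA\left(\frac{D+1}{2}\right)^2}&\text{if }\delta\le n+\alpha.\end{cases}$$ (iii) Let $p=2$ and $\alpha+1\ge n$. Then $$G(a,b,c;S;2^n)=\begin{cases}2^n&\text{if }n>1,\\ (-1)^c\left(1+(-1)^{b+1}\right)&\text{if }n=1.\end{cases}$$ -/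

import Mathlib

/-- The double quadratic Gauss sum
`G(a,b,c;S;k) = ∑_{x,y=0}^{k-1} e(S(ax²+bxy+cy²)/k)`, where `e(t) = exp(2πit)`. -/
noncomputable def doubleGaussSum (a b c S : ℤ) (k : ℕ) : ℂ :=
  ∑ x ∈ Finset.range k, ∑ y ∈ Finset.range k,
    Complex.exp (2 * Real.pi * Complex.I *
      (((S * (a * (x : ℤ) ^ 2 + b * (x : ℤ) * (y : ℤ) + c * (y : ℤ) ^ 2) : ℤ) : ℂ) / (k : ℂ)))

/-- The Kronecker symbol `(2/m)` for an odd integer `m` of either sign. For positive `m` it is the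
Jacobi symbol, and `m` and `-m` give the same value, because the Kronecker symbol of `2` over `-1` is `1`. -/
def kroneckerTwo (m : ℤ) : ℤ := jacobiSym 2 m.natAbs

/-! A form whose leading coefficient is prime to $p$ (that is, $\alpha=0$) is diagonalised by
completing the square. For odd $p$, $4aQ=(2ax+by)^2+\Delta y^2$; for $p=2$ and $b=2b'$,
$aQ=(ax+b'y)^2+(\Delta/4)y^2$. The double sum then factors as $g(u)\,g(uE)$ with $g(u;N)=\sum_x
e(ux^2/N)$ (`doubleGaussSum_eq_mul`). If $E\equiv p^dD$, the second factor drops to modulus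
$p^{n-d}$ at the cost of $p^d$.

If $\alpha>0$, then $p$ divides $a$ and $c$, so by primitivity not $b$. The same unit cross term
occurs for $p=2$ and $b$ odd. No square is completed: orthogonality in $y$ and then in $x$ leaves
only multiples of $p$, so the modulus falls by $p^2$ while the sum falls by $p^2$
(`doubleGaussSum_mul_mul`). The value is $p^n$ for $p\mid c$ and $(-2)^n$ for $a,b,c$ all odd,
$p=2$. Here $\Delta$ is a unit, and the general formula collapses to the same value.

The sums $g$ descend from $p^{n+2}$ to $p^n$ in the same way, which leaves the modulus $p$ for odd
$p$ and the moduli $4$, $8$ for $p=2$. Modulus $p$ needs the sign of Gauss's sum. It comes from the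
functional equation of the theta series at $w=t-2i/N$: as $t\to0^+$, one side isolates $g(1;N)$, the
other a two-term sum modulo $4$ (`quadraticGaussSum_one_mul`). -/

/-! ### Asymptotics of theta series with periodic coefficients -/

open Filter Topology in
/-- A Gaussian series with a bounded phase tends to its central term as the width shrinks. -/
theorem tendsto_tsum_gaussian_mul_phase {ι : Type*} {l : Filter ι} [l.IsCountablyGenerated]
    {v : ι → ℂ} (hv : Tendsto (fun t => (v t).re) l atTop) {θ : ℤ → ℂ}
    (hθ : ∀ m, ‖θ m‖ ≤ 1) (h0 : θ 0 = 1) :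
    Tendsto (fun t => ∑' m : ℤ, Complex.exp (-Real.pi * v t * (m : ℂ) ^ 2) * θ m) l (𝓝 1) := by
  have hnorm : ∀ t (m : ℤ), ‖Complex.exp (-Real.pi * v t * (m : ℂ) ^ 2)‖
      = Real.exp (-Real.pi * (v t).re * (m : ℝ) ^ 2) := by
    intro t m
    rw [Complex.norm_exp]
    congr 1
    rw [show (-Real.pi * v t * (m : ℂ) ^ 2 : ℂ) = ((-Real.pi * (m : ℝ) ^ 2 : ℝ) : ℂ) * v t by
      push_cast; ring, Complex.re_ofReal_mul]
    ring
  have hb : Summable fun m : ℤ => Real.exp (-Real.pi * (m : ℝ) ^ 2) := by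
    have := summable_pow_mul_jacobiTheta₂_term_bound 0 one_pos 0
    simpa using this
  have hone : (1 : ℂ) = ∑' m : ℤ, if m = 0 then (1 : ℂ) else 0 := by rw [tsum_ite_eq]
  rw [hone]
  refine tendsto_tsum_of_dominated_convergence hb ?_ ?_
  · intro m
    split_ifs with hm
    · subst hm; simp [h0, tendsto_const_nhds]
    · rw [tendsto_zero_iff_norm_tendsto_zero]
      have h1 : Tendsto (fun t => Real.exp (-Real.pi * (v t).re * (m : ℝ) ^ 2)) l (𝓝 0) := by
        refine Real.tendsto_exp_atBot.comp ?_
        have hm2 : (0 : ℝ) < Real.pi * (m : ℝ) ^ 2 := by positivity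
        have := tendsto_neg_atTop_atBot.comp (hv.const_mul_atTop hm2)
        refine this.congr fun t => ?_
        simp only [Function.comp]; ring
      refine squeeze_zero (fun _ => norm_nonneg _) (fun t => ?_) h1
      rw [norm_mul, hnorm]
      exact mul_le_of_le_one_right (Real.exp_pos _).le (hθ m)
  · filter_upwards [hv.eventually_ge_atTop 1] with t ht m
    rw [norm_mul, hnorm]
    refine (mul_le_of_le_one_right (Real.exp_pos _).le (hθ m)).trans ?_
    refine Real.exp_le_exp.mpr ?_
    have : 0 ≤ Real.pi * (m : ℝ) ^ 2 := by positivity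
    nlinarith

/-- Poisson summation for a Gaussian over an arithmetic progression. -/
theorem tsum_gaussian_arith_progression {N : ℕ} (hN : N ≠ 0) {z : ℂ} (hz : 0 < z.re) (r : ℂ) :
    ((N : ℂ) ^ 2 * z) ^ (1 / 2 : ℂ) * ∑' m : ℤ, Complex.exp (-Real.pi * z * (N * m + r) ^ 2) =
      ∑' m : ℤ, Complex.exp (-Real.pi * (1 / (N ^ 2 * z)) * (m : ℂ) ^ 2) *
        Complex.exp (2 * Real.pi * Complex.I * (m * r / N)) := by
  have hz0 : z ≠ 0 := by rintro rfl; simp at hz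
  have hN0 : (N : ℂ) ≠ 0 := by exact_mod_cast hN
  have ha : 0 < ((N : ℂ) ^ 2 * z).re := by
    rw [show (N : ℂ) ^ 2 * z = (((N : ℝ) ^ 2 : ℝ) : ℂ) * z by push_cast; ring,
      Complex.re_ofReal_mul]
    have : (0 : ℝ) < N := by exact_mod_cast Nat.pos_of_ne_zero hN
    positivity
  have key := Complex.tsum_exp_neg_quadratic ha (-(N * r * z))
  have hpow : ((N : ℂ) ^ 2 * z) ^ (1 / 2 : ℂ) ≠ 0 := by
    rw [Complex.cpow_ne_zero_iff]; left; positivity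
  have h1 : ∀ m : ℤ, Complex.exp (-Real.pi * z * (N * m + r) ^ 2) =
      Complex.exp (-Real.pi * z * r ^ 2) * Complex.exp (-Real.pi * (N ^ 2 * z) * m ^ 2
        + 2 * Real.pi * (-(N * r * z)) * m) := by
    intro m; rw [← Complex.exp_add]; congr 1; ring
  have h2 : ∀ m : ℤ, Complex.exp (-Real.pi / (N ^ 2 * z) * (m + Complex.I * (-(N * r * z))) ^ 2)
      = Complex.exp (Real.pi * z * r ^ 2) *
        (Complex.exp (-Real.pi * (1 / (N ^ 2 * z)) * (m : ℂ) ^ 2) *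
        Complex.exp (2 * Real.pi * Complex.I * (m * r / N))) := by
    intro m; rw [← Complex.exp_add, ← Complex.exp_add]; congr 1
    field_simp
    ring_nf
    rw [Complex.I_sq]; ring
  simp_rw [h1, tsum_mul_left, key, h2]
  rw [tsum_mul_left]
  have h3 : Complex.exp (-Real.pi * z * r ^ 2) * Complex.exp (Real.pi * z * r ^ 2) = 1 := by
    rw [← Complex.exp_add, ← Complex.exp_zero]; congr 1; ring
  generalize ∑' m : ℤ, (_ : ℂ) = T
  generalize ((N : ℂ) ^ 2 * z) ^ (1 / 2 : ℂ) = P at *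
  generalize Complex.exp (-Real.pi * z * r ^ 2) = E at *
  generalize Complex.exp (Real.pi * z * r ^ 2) = E' at *
  field_simp
  linear_combination T * h3

theorem summable_gaussian {z : ℂ} (hz : 0 < z.re) :
    Summable fun n : ℤ => Complex.exp (-Real.pi * z * (n : ℂ) ^ 2) := by
  have h : 0 < (Complex.I * z).im := by simpa using hz
  refine (hasSum_jacobiTheta₂_term 0 h).summable.congr fun n => ?_
  rw [jacobiTheta₂_term]
  congr 1
  linear_combination (-Real.pi * (n : ℂ) ^ 2 * z) * Complex.I_sq.symm

theorem tsum_int_eq_sum_residue {N : ℕ} (hN : N ≠ 0) {f : ℤ → ℂ} (hf : Summable f) :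
    ∑' n : ℤ, f n = ∑ r ∈ Finset.range N, ∑' m : ℤ, f (m * N + r) := by
  have : NeZero N := ⟨hN⟩
  have hse := ((Equiv.prodComm _ _).trans (Int.divModEquiv N).symm).summable_iff.mpr hf
  rw [← ((Equiv.prodComm _ _).trans (Int.divModEquiv N).symm).tsum_eq f]
  refine hse.tsum_prod.trans ?_
  rw [tsum_fintype, Finset.sum_range]
  rfl

/-- The leading asymptotics of a theta series with periodic coefficients. -/
theorem tendsto_sqrt_mul_tsum_periodic {ι : Type*} {l : Filter ι} [l.IsCountablyGenerated]
    {N : ℕ} (hN : N ≠ 0) {c : ℤ → ℂ} (hc : ∀ m r, c (m * N + r) = c r)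
    (hc1 : ∀ n, ‖c n‖ ≤ 1) {z : ι → ℂ}
    (hz : ∀ᶠ t in l, 0 < (z t).re)
    (hz' : Filter.Tendsto (fun t => (1 / z t).re) l Filter.atTop) :
    Filter.Tendsto (fun t => ((N : ℂ) ^ 2 * z t) ^ (1 / 2 : ℂ) *
      ∑' n : ℤ, c n * Complex.exp (-Real.pi * z t * (n : ℂ) ^ 2)) l
      (nhds (∑ r ∈ Finset.range N, c r)) := by
  have : NeZero N := ⟨hN⟩
  have hNpos : (0 : ℝ) < N := by exact_mod_cast Nat.pos_of_ne_zero hN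
  have hlim : ∀ r ∈ Finset.range N, Filter.Tendsto (fun t => c r * ∑' m : ℤ,
      Complex.exp (-Real.pi * (1 / (N ^ 2 * z t)) * (m : ℂ) ^ 2) *
        Complex.exp (2 * Real.pi * Complex.I * (m * r / N))) l (nhds (c r * 1)) := by
    intro r _
    refine Filter.Tendsto.const_mul _ (tendsto_tsum_gaussian_mul_phase ?_ ?_ ?_)
    · have := hz'.const_mul_atTop (show (0 : ℝ) < 1 / N ^ 2 by positivity)
      refine this.congr fun t => ?_
      rw [← Complex.re_ofReal_mul]
      congr 1
      push_cast
      rw [one_div_mul_one_div]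
    · intro m
      rw [show (2 * Real.pi * Complex.I * (m * r / N) : ℂ)
        = ((2 * Real.pi * (m * r / N) : ℝ) : ℂ) * Complex.I by push_cast; ring,
        Complex.norm_exp_ofReal_mul_I]
    · simp
  have hsum := tendsto_finsetSum _ hlim
  simp only [mul_one] at hsum
  refine hsum.congr' ?_
  filter_upwards [hz] with t ht
  have hs0 := summable_gaussian ht
  have hs : Summable fun n : ℤ => c n * Complex.exp (-Real.pi * z t * (n : ℂ) ^ 2) := by
    refine hs0.norm.of_norm_bounded fun n => ?_
    rw [norm_mul]
    exact mul_le_of_le_one_left (norm_nonneg _) (hc1 n)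
  rw [tsum_int_eq_sum_residue hN hs, Finset.mul_sum]
  refine Finset.sum_congr rfl fun r _ => ?_
  rw [← tsum_gaussian_arith_progression hN ht]
  simp_rw [hc, tsum_mul_left]
  push_cast
  simp_rw [mul_comm (N : ℂ) (_ : ℂ)]
  ring

/-! ### The additive character modulo N -/

/-- The additive character `m ↦ exp(2πi m / N)`. -/
noncomputable def unitExp (N : ℕ) (m : ℤ) : ℂ :=
  Complex.exp (2 * Real.pi * Complex.I * ((m : ℂ) / (N : ℂ)))

theorem unitExp_add (N : ℕ) (m k : ℤ) : unitExp N (m + k) = unitExp N m * unitExp N k := by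
  simp only [unitExp]; rw [← Complex.exp_add]; congr 1; push_cast; ring


@[simp] theorem unitExp_zero (N : ℕ) : unitExp N 0 = 1 := by simp [unitExp]

theorem norm_unitExp (N : ℕ) (m : ℤ) : ‖unitExp N m‖ = 1 := by
  rw [unitExp, show (2 * Real.pi * Complex.I * ((m : ℂ) / N) : ℂ)
    = ((2 * Real.pi * (m / N) : ℝ) : ℂ) * Complex.I by push_cast; ring,
    Complex.norm_exp_ofReal_mul_I]

theorem unitExp_eq_one_iff {N : ℕ} (hN : N ≠ 0) (m : ℤ) : unitExp N m = 1 ↔ (N : ℤ) ∣ m := by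
  have h0 : (2 * Real.pi * Complex.I : ℂ) ≠ 0 := Complex.two_pi_I_ne_zero
  have hN0 : (N : ℂ) ≠ 0 := by exact_mod_cast hN
  rw [unitExp, Complex.exp_eq_one_iff]
  constructor
  · rintro ⟨k, hk⟩
    rw [mul_comm (k : ℂ)] at hk
    have := mul_left_cancel₀ h0 hk
    rw [div_eq_iff hN0] at this
    exact ⟨k, by rw [mul_comm]; exact_mod_cast this⟩
  · rintro ⟨k, rfl⟩
    refine ⟨k, ?_⟩
    push_cast
    field_simp

theorem unitExp_congr {N : ℕ} (hN : N ≠ 0) {m k : ℤ} (h : m ≡ k [ZMOD N]) :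
    unitExp N m = unitExp N k := by
  have : unitExp N (m - k) = 1 := (unitExp_eq_one_iff hN _).mpr h.symm.dvd
  rw [← sub_add_cancel m k, unitExp_add, this, one_mul]

theorem unitExp_mul_left {q : ℕ} (hq : q ≠ 0) (N : ℕ) (m : ℤ) :
    unitExp (q * N) (q * m) = unitExp N m := by
  have hq0 : (q : ℂ) ≠ 0 := by exact_mod_cast hq
  simp only [unitExp]
  push_cast
  rw [mul_div_mul_left _ _ hq0]

/-! ### The sign of the quadratic Gauss sum -/

/-- The quadratic Gauss sum `∑_{x mod N} e(u x² / N)`. -/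
noncomputable def quadraticGaussSum (u : ℤ) (N : ℕ) : ℂ :=
  ∑ x ∈ Finset.range N, unitExp N (u * (x : ℤ) ^ 2)

/-- $(1-i)/\sqrt N$ squares to $-2i/N$ and has positive real part, so it is the principal root. This
choice of branch is what fixes the sign of the Gauss sum. -/
theorem cpow_half_neg_two_I_div {N : ℕ} (hN : N ≠ 0) :
    (-(2 * Complex.I / N) : ℂ) ^ (1 / 2 : ℂ) = (1 - Complex.I) / (Real.sqrt N : ℝ) := by
  have hNpos : (0 : ℝ) < N := by exact_mod_cast Nat.pos_of_ne_zero hN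
  have hs : (((Real.sqrt N : ℝ) : ℂ)) ^ 2 = N := by
    rw [← Complex.ofReal_pow, Real.sq_sqrt hNpos.le]; simp
  have hsq : (-(2 * Complex.I / N) : ℂ) = ((1 - Complex.I) / (Real.sqrt N : ℝ)) ^ 2 := by
    rw [div_pow, hs, sub_sq, Complex.I_sq]; ring
  rw [hsq, show (1 / 2 : ℂ) = 2⁻¹ by norm_num, Complex.sq_cpow_two_inv]
  rw [Complex.div_ofReal_re]
  simp [hNpos]

open Filter Topology in
/-- The value of the quadratic Gauss sum of odd modulus, with its sign. -/
theorem quadraticGaussSum_one_mul {N : ℕ} (hN : Odd N) :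
    quadraticGaussSum 1 N * (1 - Complex.I) = (Real.sqrt N : ℝ) * (1 + (-Complex.I) ^ N) := by
  have hN0 : N ≠ 0 := by rintro rfl; simp at hN
  have hNpos : (0 : ℝ) < N := by exact_mod_cast Nat.pos_of_ne_zero hN0
  have hNC : (N : ℂ) ≠ 0 := by exact_mod_cast hN0
  set l : Filter ℝ := 𝓝[>] 0 with hl
  have hpos : ∀ᶠ t : ℝ in l, 0 < t := self_mem_nhdsWithin
  have hid : Tendsto (fun t : ℝ => (t : ℂ)) l (𝓝 0) := by
    have : Tendsto (fun t : ℝ => (t : ℂ)) (𝓝 0) (𝓝 ((0 : ℝ) : ℂ)) :=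
      Complex.continuous_ofReal.tendsto 0
    simpa using this.mono_left nhdsWithin_le_nhds
  -- the theta series on both sides of the functional equation
  let c : ℤ → ℂ := fun n => unitExp N (n ^ 2)
  let c' : ℤ → ℂ := fun n => unitExp 4 (-(N * n ^ 2))
  let z' : ℝ → ℂ := fun t => (N : ℂ) ^ 2 * t / (4 + 2 * Complex.I * N * t)
  have hden : ∀ t : ℝ, (4 + 2 * Complex.I * N * t : ℂ) ≠ 0 := by
    intro t h
    have := congrArg Complex.re h
    simp at this
  have hzinv : ∀ t : ℝ, 0 < t → 1 / z' t = ((4 / (N ^ 2 * t) : ℝ) : ℂ) + 2 / N * Complex.I := by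
    intro t ht
    have ht0 : (t : ℂ) ≠ 0 := by exact_mod_cast ht.ne'
    have := hden t
    simp only [z']
    push_cast
    field_simp
  have hre : ∀ t : ℝ, 0 < t → (1 / z' t).re = 4 / (N ^ 2 * t) := by
    intro t ht
    rw [hzinv t ht, Complex.add_re, Complex.ofReal_re, Complex.mul_I_re]
    have : ((2 : ℂ) / N).im = 0 := by
      rw [show ((2 : ℂ) / N) = ((2 / N : ℝ) : ℂ) by push_cast; rfl, Complex.ofReal_im]
    rw [this]; simp
  have lim1 := tendsto_sqrt_mul_tsum_periodic (l := l) hN0 (c := c) (z := fun t : ℝ => (t : ℂ))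
    (by
      intro m r
      refine unitExp_congr hN0 ?_
      rw [Int.modEq_iff_dvd]
      exact ⟨-(m * (m * N + 2 * r)), by ring⟩)
    (fun n => (norm_unitExp _ _).le)
    (by filter_upwards [hpos] with t ht; simpa using ht)
    (by
      refine (tendsto_inv_nhdsGT_zero (𝕜 := ℝ)).congr fun t => ?_
      rw [one_div, ← Complex.ofReal_inv, Complex.ofReal_re])
  have lim2 := tendsto_sqrt_mul_tsum_periodic (l := l) two_ne_zero (c := c') (z := z')
    (by
      intro m r
      refine unitExp_congr (by norm_num) ?_
      rw [Int.modEq_iff_dvd]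
      exact ⟨N * m * (m + r), by push_cast; ring⟩)
    (fun n => (norm_unitExp _ _).le)
    (by
      filter_upwards [hpos] with t ht
      have h := hre t ht
      by_contra hcon
      -- Inversion preserves the sign of the real part, so positivity passes from `1 / z' t` to `z'
      -- t`.
      rw [one_div, Complex.inv_re] at h
      have h1 : 0 < 4 / ((N : ℝ) ^ 2 * t) := by positivity
      rw [← h] at h1
      exact absurd h1 (not_lt.mpr (div_nonpos_of_nonpos_of_nonneg (not_lt.mp hcon)
        (Complex.normSq_nonneg _))))
    (by
      have := (tendsto_inv_nhdsGT_zero (𝕜 := ℝ)).const_mul_atTop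
        (show (0 : ℝ) < 4 / N ^ 2 by positivity)
      refine this.congr' ?_
      filter_upwards [hpos] with t ht
      rw [hre t ht]
      field_simp)
  -- The theta series is evaluated at $w$, where the phase $-2i/N$ turns each term into $e(n^2/N)$
  -- times a Gaussian of parameter $t$. Since $1/w=z'+iN/2$, the dual series carries the
  -- coefficients $e(-Nn^2/4)$, of period $2$ in $n$.
  let w : ℝ → ℂ := fun t => t + -(2 * Complex.I / N)
  have limw : Tendsto (fun t => w t ^ (1 / 2 : ℂ)) l
      (𝓝 ((1 - Complex.I) / (Real.sqrt N : ℝ))) := by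
    rw [← cpow_half_neg_two_I_div hN0]
    have h : Tendsto w l (𝓝 (-(2 * Complex.I / N))) := by
      simpa [w] using hid.add_const (-(2 * Complex.I / N))
    refine h.cpow tendsto_const_nhds ?_
    right
    have : (-(2 * Complex.I / N) : ℂ).im = -(2 / N) := by
      rw [show (-(2 * Complex.I / N) : ℂ) = ((-(2 / N) : ℝ) : ℂ) * Complex.I by push_cast; ring,
        Complex.im_ofReal_mul, Complex.I_im, mul_one]
    rw [this]
    have : (0 : ℝ) < 2 / N := by positivity
    exact (neg_neg_of_pos this).ne
  have limK : Tendsto (fun t : ℝ => ((4 * N ^ 2 : ℂ) / (4 + 2 * Complex.I * N * t)) ^ (1 / 2 : ℂ))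
      l (𝓝 N) := by
    have h1 : Tendsto (fun t : ℝ => ((4 * N ^ 2 : ℂ) / (4 + 2 * Complex.I * N * t))) l
        (𝓝 ((4 * N ^ 2 : ℂ) / (4 + 2 * Complex.I * N * 0))) :=
      tendsto_const_nhds.div (tendsto_const_nhds.add (tendsto_const_nhds.mul hid)) (by simp)
    have h2 : ((4 * N ^ 2 : ℂ) / (4 + 2 * Complex.I * N * 0)) = (N : ℂ) ^ 2 := by
      rw [mul_zero, add_zero]; field_simp
    rw [h2] at h1
    have h3 : ((N : ℂ) ^ 2) ^ (1 / 2 : ℂ) = N := by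
      rw [show (1 / 2 : ℂ) = 2⁻¹ by norm_num, Complex.sq_cpow_two_inv]
      simpa using hNpos
    have h4 := h1.cpow (tendsto_const_nhds (x := (1 / 2 : ℂ))) (by
      left; rw [← Nat.cast_pow, Complex.natCast_re]; positivity)
    rwa [h3] at h4
  have heq : ∀ᶠ t : ℝ in l,
      w t ^ (1 / 2 : ℂ) * (((4 * N ^ 2 : ℂ) / (4 + 2 * Complex.I * N * t)) ^ (1 / 2 : ℂ) *
        (((N : ℂ) ^ 2 * t) ^ (1 / 2 : ℂ) *
          ∑' n : ℤ, c n * Complex.exp (-Real.pi * t * (n : ℂ) ^ 2))) =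
      N * (((2 : ℕ) : ℂ) ^ 2 * z' t) ^ (1 / 2 : ℂ) *
          ∑' n : ℤ, c' n * Complex.exp (-Real.pi * z' t * (n : ℂ) ^ 2) := by
    filter_upwards [hpos] with t ht
    have ht0 : (t : ℂ) ≠ 0 := by exact_mod_cast ht.ne'
    have hdt := hden t
    have hwre : 0 < (w t).re := by
      have : (-(2 * Complex.I / N) : ℂ).re = 0 := by
        rw [show (-(2 * Complex.I / N) : ℂ) = ((-(2 / N) : ℝ) : ℂ) * Complex.I by push_cast; ring,
          Complex.re_ofReal_mul, Complex.I_re, mul_zero]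
      simp only [w, Complex.add_re, Complex.ofReal_re, this, add_zero]
      exact ht
    have hw0 : w t ≠ 0 := by intro h; rw [h] at hwre; simp at hwre
    have hw1 : 1 / w t = z' t + Complex.I * N / 2 := by
      rw [div_eq_iff hw0]
      simp only [w, z']
      obtain ⟨q, hq⟩ : ∃ q, q = (4 + 2 * Complex.I * N * t : ℂ) := ⟨_, rfl⟩
      rw [← hq] at hdt ⊢
      field_simp
      linear_combination (-(N : ℂ) * t * Complex.I) * hq +
        (2 * q - 2 * (N : ℂ) ^ 2 * t ^ 2) * Complex.I_sq
    have key := Complex.tsum_exp_neg_mul_int_sq hwre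
    have e1 : ∀ n : ℤ, Complex.exp (-Real.pi * w t * (n : ℂ) ^ 2) =
        c n * Complex.exp (-Real.pi * t * (n : ℂ) ^ 2) := by
      intro n
      simp only [c, w, unitExp]
      rw [← Complex.exp_add]; congr 1; push_cast; ring
    have e2 : ∀ n : ℤ, Complex.exp (-Real.pi / w t * (n : ℂ) ^ 2) =
        c' n * Complex.exp (-Real.pi * z' t * (n : ℂ) ^ 2) := by
      intro n
      rw [div_eq_mul_one_div, hw1]
      simp only [c', unitExp]
      rw [← Complex.exp_add]; congr 1; push_cast; ring
    simp_rw [e1, e2] at key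
    have hw2 : w t ^ (1 / 2 : ℂ) ≠ 0 := by rw [Complex.cpow_ne_zero_iff]; left; exact hw0
    have hs1 : ((N : ℂ) ^ 2 * t) ^ (1 / 2 : ℂ) = N * (t : ℂ) ^ (1 / 2 : ℂ) := by
      have := Complex.mul_cpow_ofReal_nonneg (a := (N : ℝ) ^ 2) (by positivity) ht.le (1 / 2 : ℂ)
      push_cast at this
      rw [this, show (1 / 2 : ℂ) = 2⁻¹ by norm_num, Complex.sq_cpow_two_inv]
      simpa using hNpos
    -- Principal powers are not multiplicative in general; here they are, because one factor, $t$,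
    -- is a positive real.
    have hs2 : (((2 : ℕ) : ℂ) ^ 2 * z' t) ^ (1 / 2 : ℂ) = (t : ℂ) ^ (1 / 2 : ℂ) *
        ((4 * N ^ 2 : ℂ) / (4 + 2 * Complex.I * N * t)) ^ (1 / 2 : ℂ) := by
      rw [show ((2 : ℕ) : ℂ) ^ 2 * z' t = (t : ℂ) *
        ((4 * N ^ 2 : ℂ) / (4 + 2 * Complex.I * N * t)) by simp only [z']; push_cast; ring]
      have hq : (4 * N ^ 2 : ℂ) / (4 + 2 * Complex.I * N * t) ≠ 0 :=
        div_ne_zero (by simpa using hN0) hdt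
      rw [Complex.cpow_def_of_ne_zero (mul_ne_zero ht0 hq), Complex.cpow_def_of_ne_zero ht0,
        Complex.cpow_def_of_ne_zero hq, Complex.log_ofReal_mul ht hq, add_mul, Complex.exp_add,
        Complex.ofReal_log ht.le]
    rw [key, hs1, hs2]
    field_simp
  have limL := limw.mul (limK.mul lim1)
  have limR := lim2.const_mul (N : ℂ)
  have hfin := tendsto_nhds_unique (limL.congr' heq) (by simpa only [mul_assoc] using limR)
  have hG : ∑ r ∈ Finset.range N, c r = quadraticGaussSum 1 N := by
    simp [quadraticGaussSum, c]
  have hR : ∑ r ∈ Finset.range 2, c' r = 1 + (-Complex.I) ^ N := by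
    have : unitExp 4 (-N) = (-Complex.I) ^ N := by
      rw [← Complex.exp_neg_pi_div_two_mul_I, ← Complex.exp_nat_mul, unitExp]
      congr 1; push_cast; ring
    simp [Finset.sum_range_succ, c', this]
  rw [hG, hR] at hfin
  have hs : ((Real.sqrt N : ℝ) : ℂ) ≠ 0 := by
    rw [Ne, Complex.ofReal_eq_zero, Real.sqrt_eq_zero hNpos.le]; exact hNpos.ne'
  have hfin' : (1 - Complex.I) / (Real.sqrt N : ℝ) * quadraticGaussSum 1 N
      = 1 + (-Complex.I) ^ N := by
    apply mul_left_cancel₀ hNC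
    rw [← hfin]; ring
  rw [← hfin']
  field_simp

/-! ### Sums over residues: orthogonality and changes of variable -/

theorem sum_range_mul_eq (M N : ℕ) (f : ℕ → ℂ) :
    ∑ x ∈ Finset.range (M * N), f x =
      ∑ t ∈ Finset.range M, ∑ x ∈ Finset.range N, f (x + N * t) := by
  induction M with
  | zero => simp
  | succ M ih =>
    rw [add_mul, one_mul, Finset.sum_range_add, ih, Finset.sum_range_succ]
    congr 1
    exact Finset.sum_congr rfl fun x _ => by rw [add_comm, mul_comm]

theorem sum_range_mul_periodic (M N : ℕ) {f : ℕ → ℂ} (hf : ∀ x t, f (x + N * t) = f x) :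
    ∑ x ∈ Finset.range (M * N), f x = M * ∑ x ∈ Finset.range N, f x := by
  rw [sum_range_mul_eq]
  simp [hf]

theorem sum_range_mul_ite_dvd {p : ℕ} (hp : p ≠ 0) (N : ℕ) (f : ℕ → ℂ) :
    ∑ x ∈ Finset.range (p * N), (if p ∣ x then f x else 0) =
      ∑ x ∈ Finset.range N, f (p * x) := by
  rw [mul_comm, sum_range_mul_eq]
  refine Finset.sum_congr rfl fun t _ => ?_
  rw [Finset.sum_eq_single_of_mem 0 (by simpa using Nat.pos_of_ne_zero hp)]
  · simp
  · intro x hx hx0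
    rw [if_neg]
    rw [Nat.dvd_add_left (dvd_mul_right _ _)]
    exact fun h => hx0 (Nat.eq_zero_of_dvd_of_lt h (Finset.mem_range.mp hx))

theorem unitExp_mul_natCast (N : ℕ) (k : ℤ) (t : ℕ) : unitExp N (k * t) = unitExp N k ^ t := by
  rw [unitExp, unitExp, ← Complex.exp_nat_mul]; congr 1; push_cast; ring

theorem sum_unitExp_mul {p : ℕ} (hp : p ≠ 0) (k : ℤ) :
    ∑ t ∈ Finset.range p, unitExp p (k * t) = if (p : ℤ) ∣ k then (p : ℂ) else 0 := by
  simp_rw [unitExp_mul_natCast]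
  split_ifs with h
  · simp [(unitExp_eq_one_iff hp k).mpr h]
  · have h1 : unitExp p k ≠ 1 := fun h' => h ((unitExp_eq_one_iff hp k).mp h')
    rw [geom_sum_eq h1, ← unitExp_mul_natCast,
      (unitExp_eq_one_iff hp _).mpr (dvd_mul_left _ _), sub_self, zero_div]

/-- A sum over `ℤ/pK` of a function that translation by `K` multiplies by a character of `ℤ/p`. -/
theorem sum_range_mul_of_twist {p : ℕ} (hp : p ≠ 0) (K : ℕ) {k : ℕ → ℤ} {f : ℕ → ℂ}
    (h : ∀ x t : ℕ, f (x + K * t) = f x * unitExp p (k x * t)) :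
    ∑ x ∈ Finset.range (p * K), f x =
      p * ∑ x ∈ Finset.range K, if (p : ℤ) ∣ k x then f x else 0 := by
  rw [sum_range_mul_eq, Finset.sum_comm, Finset.mul_sum]
  refine Finset.sum_congr rfl fun x _ => ?_
  simp_rw [h, ← Finset.mul_sum, sum_unitExp_mul hp]
  split_ifs <;> ring

theorem natCast_dvd_mul_of_isCoprime {p : ℕ} {k : ℤ} (hk : IsCoprime k p) (x : ℕ) :
    (p : ℤ) ∣ k * x ↔ p ∣ x := by
  rw [← Int.natCast_dvd_natCast]
  exact ⟨fun h => IsCoprime.dvd_of_dvd_mul_left hk.symm h, fun h => dvd_mul_of_dvd_right h _⟩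

/-- Translation by $pM$ twists the summand by a character of $t$ that is trivial exactly when $p\mid
x$, so averaging over $t$ kills every other $x$. This is the mechanism behind all descents of
one-variable sums. -/
theorem sum_range_descent {p : ℕ} (hp : p ≠ 0) (M : ℕ) {k : ℤ} (hk : IsCoprime k p) {f : ℕ → ℂ}
    (h : ∀ x t : ℕ, f (x + p * M * t) = f x * unitExp p (k * x * t)) :
    ∑ x ∈ Finset.range (p * (p * M)), f x = p * ∑ x ∈ Finset.range M, f (p * x) := by
  rw [sum_range_mul_of_twist hp (p * M) (k := fun x => k * x) h]
  simp_rw [natCast_dvd_mul_of_isCoprime hk]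
  rw [sum_range_mul_ite_dvd hp]

theorem sum_range_eq_sum_zmod {N : ℕ} [NeZero N] (G : ZMod N → ℂ) :
    ∑ x ∈ Finset.range N, G (x : ZMod N) = ∑ z, G z := by
  refine Finset.sum_nbij' (fun x => (x : ZMod N)) ZMod.val ?_ ?_ ?_ ?_ ?_
  · simp
  · intro z _; simpa using ZMod.val_lt z
  · intro x hx; exact ZMod.val_cast_of_lt (by simpa using hx)
  · intro z _; simp
  · simp

theorem sum_range_affine {N : ℕ} (hN : N ≠ 0) {g : ℤ → ℂ}
    (hg : ∀ m k : ℤ, m ≡ k [ZMOD N] → g m = g k) {v : ℤ} (hv : IsCoprime v N) (w : ℤ) :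
    ∑ x ∈ Finset.range N, g (v * x + w) = ∑ x ∈ Finset.range N, g x := by
  have : NeZero N := ⟨hN⟩
  have hG : ∀ m : ℤ, g ((m : ZMod N).val : ℤ) = g m := by
    intro m
    refine hg _ _ ?_
    rw [← ZMod.intCast_eq_intCast_iff]
    simp
  have hvu : IsUnit (v : ZMod N) := by
    obtain ⟨r, s, hrs⟩ := hv
    refine IsUnit.of_mul_eq_one (r : ZMod N) ?_
    have := congrArg (Int.cast : ℤ → ZMod N) hrs
    push_cast at this
    rw [ZMod.natCast_self, mul_zero, add_zero] at this
    rw [mul_comm]; exact this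
  have h1 := sum_range_eq_sum_zmod fun z : ZMod N => g (((v : ZMod N) * z + w).val : ℤ)
  have h2 := sum_range_eq_sum_zmod fun z : ZMod N => g (z.val : ℤ)
  have hbij : Function.Bijective fun z : ZMod N => (v : ZMod N) * z + w :=
    (AddGroup.addRight_bijective _).comp (IsUnit.isUnit_iff_mulLeft_bijective.mp hvu)
  have h3 := hbij.sum_comp fun z => g (z.val : ℤ)
  rw [h3, ← h2] at h1
  have e1 : ∀ x : ℕ, g (((v : ZMod N) * x + w).val : ℤ) = g (v * x + w) := by
    intro x; rw [← hG (v * x + w)]; push_cast; rfl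
  have e2 : ∀ x : ℕ, g ((x : ZMod N).val : ℤ) = g x := by
    intro x; rw [← hG x]; push_cast; rfl
  simpa only [e1, e2] using h1

/-! ### Quadratic Gauss sums of prime power modulus -/

theorem quadraticGaussSum_congr {N : ℕ} (hN : N ≠ 0) {u u' : ℤ} (h : u ≡ u' [ZMOD N]) :
    quadraticGaussSum u N = quadraticGaussSum u' N :=
  Finset.sum_congr rfl fun _ _ => unitExp_congr hN (h.mul_right _)

theorem quadraticGaussSum_mul_left {q : ℕ} (hq : q ≠ 0) {N : ℕ} (hN : N ≠ 0) (u : ℤ) :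
    quadraticGaussSum (q * u) (q * N) = q * quadraticGaussSum u N := by
  rw [quadraticGaussSum, quadraticGaussSum]
  simp_rw [mul_assoc, unitExp_mul_left hq]
  refine sum_range_mul_periodic q N fun x t => unitExp_congr hN ?_
  rw [Int.modEq_iff_dvd]
  exact ⟨-(u * t * (2 * x + N * t)), by push_cast; ring⟩

/-- In $u(x+pMt)^2$ the last term vanishes modulo $p^2M$ and the cross term is the character
$e(2uxt/p)$, nontrivial for $p\nmid x$ because $2u$ is a unit. -/
theorem quadraticGaussSum_mul_mul {p : ℕ} (hp : p ≠ 0) {M : ℕ} (hM : M ≠ 0) {u : ℤ}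
    (hu : IsCoprime (2 * u) p) :
    quadraticGaussSum u (p * (p * M)) = p * quadraticGaussSum u M := by
  have hN : p * (p * M) ≠ 0 := by positivity
  rw [quadraticGaussSum, quadraticGaussSum, sum_range_descent hp M hu]
  · congr 1
    refine Finset.sum_congr rfl fun x _ => ?_
    rw [← unitExp_mul_left hp M, ← unitExp_mul_left hp (p * M)]
    congr 1; push_cast; ring
  · intro x t
    have : unitExp p (2 * u * x * t) = unitExp (p * (p * M)) (p * M * (2 * u * x * t)) := by
      rw [← unitExp_mul_left (mul_ne_zero hp hM)]
      push_cast
      congr 1; ring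
    rw [this, ← unitExp_add]
    refine unitExp_congr hN ?_
    rw [Int.modEq_iff_dvd]
    exact ⟨-(u * M * t ^ 2), by push_cast; ring⟩

/-- Over moduli `2 * M` with `M` even, the summand of the quadratic Gauss sum has period `M`. -/
theorem quadraticGaussSum_two_mul {M : ℕ} (hM : M ≠ 0) (h2 : 2 ∣ M) (u : ℤ) :
    quadraticGaussSum u (2 * M) =
      2 * ∑ x ∈ Finset.range M, unitExp (2 * M) (u * (x : ℤ) ^ 2) := by
  rw [quadraticGaussSum]
  refine (sum_range_mul_periodic 2 M fun x t => unitExp_congr (by positivity) ?_).trans (by simp)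
  obtain ⟨k, rfl⟩ := h2
  rw [Int.modEq_iff_dvd]
  exact ⟨-(u * (x * t + k * t ^ 2)), by push_cast; ring⟩

/-- At $2$ the factor $2$ in the cross term would make the twist trivial. Halving the range first,
by periodicity, allows a shift half as long, whose cross term is $e(uxt/2)$. -/
theorem quadraticGaussSum_two_pow_add_four (n : ℕ) {u : ℤ} (hu : IsCoprime u (2 : ℕ)) :
    quadraticGaussSum u (2 ^ (n + 4)) = 2 * quadraticGaussSum u (2 ^ (n + 2)) := by
  have e4 : 2 ^ (n + 4) = 2 * (2 * (2 * 2 ^ (n + 1))) := by ring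
  have e2 : 2 ^ (n + 2) = 2 * 2 ^ (n + 1) := by ring
  have h2 : 2 ∣ 2 ^ (n + 1) := dvd_pow_self 2 (by omega)
  have hN : 2 * (2 * (2 * 2 ^ (n + 1))) ≠ 0 := by positivity
  rw [e4, e2, quadraticGaussSum_two_mul (by positivity) (dvd_mul_right _ _),
    quadraticGaussSum_two_mul (by positivity) h2,
    sum_range_descent two_ne_zero (2 ^ (n + 1)) hu]
  · push_cast
    congr 2
    refine Finset.sum_congr rfl fun x _ => ?_
    rw [← unitExp_mul_left two_ne_zero (2 * 2 ^ (n + 1)),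
      ← unitExp_mul_left two_ne_zero (2 * (2 * 2 ^ (n + 1)))]
    congr 1; push_cast; ring
  · intro x t
    have : unitExp 2 (u * x * t) =
        unitExp (2 * (2 * (2 * 2 ^ (n + 1)))) (4 * 2 ^ (n + 1) * (u * x * t)) := by
      rw [← unitExp_mul_left (q := 4 * 2 ^ (n + 1)) (by positivity)]
      push_cast
      congr 1; ring
    rw [this, ← unitExp_add]
    refine unitExp_congr hN ?_
    rw [Int.modEq_iff_dvd]
    exact ⟨-(u * 2 ^ n * t ^ 2), by push_cast; ring⟩

theorem unitExp_eq_stdAddChar {N : ℕ} [NeZero N] (m : ℤ) :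
    unitExp N m = ZMod.stdAddChar (m : ZMod N) := by
  rw [ZMod.stdAddChar_coe, unitExp]; congr 1; ring

/-- Grouping $z$ by $y=z^2$ gives each $y$ the weight $1+\chi(y)$; the constant weight contributes a
full nontrivial character sum, which is zero. -/
theorem quadraticGaussSum_eq_gaussSum {p : ℕ} [Fact p.Prime] (hp2 : p ≠ 2) {u : ℤ}
    (hu : (u : ZMod p) ≠ 0) :
    quadraticGaussSum u p =
      gaussSum ((quadraticChar (ZMod p)).ringHomComp (Int.castRingHom ℂ))
        (ZMod.stdAddChar.mulShift (u : ZMod p)) := by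
  have h1 : quadraticGaussSum u p = ∑ z : ZMod p, ZMod.stdAddChar ((u : ZMod p) * z ^ 2) := by
    rw [← sum_range_eq_sum_zmod, quadraticGaussSum]
    refine Finset.sum_congr rfl fun x _ => ?_
    rw [unitExp_eq_stdAddChar]; push_cast; rfl
  have h0 : ∑ y : ZMod p, ZMod.stdAddChar ((u : ZMod p) * y) = (0 : ℂ) := by
    have := AddChar.sum_mulShift (R := ZMod p) (R' := ℂ) (u : ZMod p)
      (ZMod.isPrimitive_stdAddChar p)
    rw [if_neg hu] at this
    simpa [mul_comm] using this
  have hF : ringChar (ZMod p) ≠ 2 := by rwa [ZMod.ringChar_zmod_n]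
  rw [h1, ← Finset.sum_fiberwise Finset.univ (fun z : ZMod p => z ^ 2), gaussSum]
  have h2 : ∀ y : ZMod p, ∑ z with z ^ 2 = y, ZMod.stdAddChar ((u : ZMod p) * z ^ 2) =
      ((quadraticChar (ZMod p)).ringHomComp (Int.castRingHom ℂ)) y *
        (ZMod.stdAddChar.mulShift (u : ZMod p)) y + ZMod.stdAddChar ((u : ZMod p) * y) := by
    intro y
    have hc := quadraticChar_card_sqrts hF y
    have : ∀ z ∈ Finset.univ.filter (fun z : ZMod p => z ^ 2 = y),
        ZMod.stdAddChar ((u : ZMod p) * z ^ 2) = (ZMod.stdAddChar ((u : ZMod p) * y) : ℂ) := by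
      intro z hz; rw [(Finset.mem_filter.mp hz).2]
    rw [Finset.sum_congr rfl this, Finset.sum_const, nsmul_eq_mul]
    have hc' : ((Finset.univ.filter (fun z : ZMod p => z ^ 2 = y)).card : ℤ)
        = quadraticChar (ZMod p) y + 1 := by
      rw [← hc]; congr 2; ext z; simp
    have hc2 := congrArg (Int.cast : ℤ → ℂ) hc'
    push_cast at hc2
    rw [hc2, AddChar.mulShift_apply, MulChar.ringHomComp_apply]
    simp only [eq_intCast]
    ring
  rw [Finset.sum_congr rfl fun y _ => h2 y, Finset.sum_add_distrib, h0, add_zero]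

theorem quadraticGaussSum_prime {p : ℕ} [Fact p.Prime] (hp2 : p ≠ 2) {u : ℤ}
    (hu : (u : ZMod p) ≠ 0) :
    quadraticGaussSum u p = jacobiSym u p * quadraticGaussSum 1 p := by
  have h1 : ((1 : ℤ) : ZMod p) ≠ 0 := by simp
  rw [quadraticGaussSum_eq_gaussSum hp2 hu, quadraticGaussSum_eq_gaussSum hp2 h1,
    ← jacobiSym.legendreSym.to_jacobiSym, legendreSym]
  have h := gaussSum_mulShift ((quadraticChar (ZMod p)).ringHomComp (Int.castRingHom ℂ))
    (ZMod.stdAddChar (N := p)) (Units.mk0 _ hu)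
  have hsq := quadraticChar_sq_one hu
  rw [Units.val_mk0, MulChar.ringHomComp_apply, eq_intCast] at h
  rw [Int.cast_one, AddChar.mulShift_one, ← h, ← mul_assoc, ← sq, ← Int.cast_pow, hsq]
  simp

/-- The square $((N-1)/2)^2$ is $0$ or $1$ modulo $4$ as $N\equiv1$ or $3$, so this power of $i$ is
the usual factor $\varepsilon_N$. -/
theorem I_pow_sq_half {N : ℕ} (h : N % 4 = 1) : Complex.I ^ (((N - 1) / 2) ^ 2) = 1 := by
  obtain ⟨k, rfl⟩ : ∃ k, N = 4 * k + 1 := ⟨N / 4, by omega⟩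
  rw [show (4 * k + 1 - 1) / 2 = 2 * k by omega, show (2 * k) ^ 2 = 4 * k ^ 2 by ring, pow_mul]
  simp

theorem I_pow_sq_half' {N : ℕ} (h : N % 4 = 3) : Complex.I ^ (((N - 1) / 2) ^ 2) = Complex.I := by
  obtain ⟨k, rfl⟩ : ∃ k, N = 4 * k + 3 := ⟨N / 4, by omega⟩
  rw [show (4 * k + 3 - 1) / 2 = 2 * k + 1 by omega,
    show (2 * k + 1) ^ 2 = 4 * (k ^ 2 + k) + 1 by ring, pow_succ, pow_mul]
  simp

theorem quadraticGaussSum_one {N : ℕ} (hN : Odd N) :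
    quadraticGaussSum 1 N = (Real.sqrt N : ℝ) * Complex.I ^ (((N - 1) / 2) ^ 2) := by
  have h := quadraticGaussSum_one_mul hN
  have hI : (1 - Complex.I) ≠ 0 := by
    intro h; have := congrArg Complex.re h; simp at this
  apply mul_right_cancel₀ hI
  rw [h]
  have hI2 : (-Complex.I) ^ 4 = 1 := by rw [neg_pow, Complex.I_pow_four]; norm_num
  have hodd : N % 4 = 1 ∨ N % 4 = 3 := by
    rcases hN with ⟨k, rfl⟩; omega
  rw [← Nat.div_add_mod N 4, pow_add, pow_mul, hI2, one_pow, one_mul, Nat.div_add_mod]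
  rcases hodd with h4 | h4
  · rw [I_pow_sq_half h4, h4]; ring
  · rw [I_pow_sq_half' h4, h4, neg_pow, Complex.I_pow_three]
    linear_combination -(Real.sqrt N : ℂ) * Complex.I_sq.symm

theorem quadraticGaussSum_modulus_one (u : ℤ) : quadraticGaussSum u 1 = 1 := by
  simp [quadraticGaussSum]

theorem jacobiSym_sq_of_isCoprime {u : ℤ} {p : ℕ} (hu : IsCoprime u p) :
    ((jacobiSym u p : ℤ) : ℂ) ^ 2 = 1 := by
  rw [← Int.cast_pow, jacobiSym.sq_one (Int.isCoprime_iff_gcd_eq_one.mp hu)]; simp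

theorem ofReal_sqrt_pow_add_two (p n : ℕ) :
    ((Real.sqrt ((p ^ (n + 2) : ℕ) : ℝ) : ℝ) : ℂ) = p * (Real.sqrt ((p ^ n : ℕ) : ℝ) : ℝ) := by
  have : Real.sqrt ((p ^ (n + 2) : ℕ) : ℝ) = p * Real.sqrt ((p ^ n : ℕ) : ℝ) := by
    rw [show ((p ^ (n + 2) : ℕ) : ℝ) = (p : ℝ) ^ 2 * ((p ^ n : ℕ) : ℝ) by push_cast; ring,
      Real.sqrt_mul (by positivity), Real.sqrt_sq (by positivity)]
  rw [this]; push_cast; rfl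

theorem quadraticGaussSum_odd_prime_pow {p : ℕ} (hp : p.Prime) (hp2 : p ≠ 2) {u : ℤ}
    (hu : IsCoprime u p) (n : ℕ) :
    quadraticGaussSum u (p ^ n) = (Real.sqrt ((p ^ n : ℕ) : ℝ) : ℝ) *
      (jacobiSym u p : ℂ) ^ n * Complex.I ^ (((p ^ n - 1) / 2) ^ 2) := by
  have := Fact.mk hp
  have hodd : Odd p := hp.odd_of_ne_two hp2
  induction n using Nat.twoStepInduction with
  | zero => simp [quadraticGaussSum_modulus_one]
  | one =>
    have hu0 : (u : ZMod p) ≠ 0 := by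
      rw [Ne, ZMod.intCast_zmod_eq_zero_iff_dvd]
      intro h
      exact (Nat.prime_iff_prime_int.mp hp).not_isUnit (hu.isUnit_of_dvd' h dvd_rfl)
    rw [pow_one, quadraticGaussSum_prime hp2 hu0, quadraticGaussSum_one hodd]
    ring
  | more n ih _ =>
    have h2 : IsCoprime (2 : ℤ) p := by
      rw [Int.isCoprime_iff_gcd_eq_one]
      exact (Nat.coprime_primes Nat.prime_two hp).mpr hp2.symm
    rw [show p ^ (n + 2) = p * (p * p ^ n) by ring,
      quadraticGaussSum_mul_mul hp.ne_zero (pow_ne_zero _ hp.ne_zero) (h2.mul_left hu), ih,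
      show p * (p * p ^ n) = p ^ (n + 2) by ring, ofReal_sqrt_pow_add_two, pow_add _ n 2,
      jacobiSym_sq_of_isCoprime hu]
    -- An odd square is $1$ modulo $4$, so the descent leaves $\varepsilon$ unchanged.
    have hmod : p ^ (n + 2) % 4 = p ^ n % 4 := by
      have : p ^ 2 % 4 = 1 := by
        obtain ⟨k, rfl⟩ := hodd
        rw [show (2 * k + 1) ^ 2 = 4 * (k ^ 2 + k) + 1 by ring]; omega
      rw [pow_add, Nat.mul_mod, this, mul_one, Nat.mod_mod]
    have h13 : p ^ n % 4 = 1 ∨ p ^ n % 4 = 3 := by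
      obtain ⟨k, hk⟩ := hodd.pow (n := n); omega
    rcases h13 with h | h
    · rw [I_pow_sq_half h, I_pow_sq_half (hmod.trans h)]; ring
    · rw [I_pow_sq_half' h, I_pow_sq_half' (hmod.trans h)]; ring

/-! ### Gauss sums of 2-power modulus -/

/-- `ZMod.χ₈` is an even character, so the absolute value in the definition is harmless. -/
theorem kroneckerTwo_eq_χ₈ {m : ℤ} (hm : Odd m) : kroneckerTwo m = ZMod.χ₈ m := by
  have hodd : Odd m.natAbs := Int.natAbs_odd.mpr hm
  rw [kroneckerTwo, jacobiSym.at_two hodd]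
  rcases Int.natAbs_eq m with h | h
  · conv_rhs => rw [h]
    simp
  · conv_rhs => rw [h]
    rw [Int.cast_neg, Int.cast_natCast]
    generalize (m.natAbs : ZMod 8) = z
    revert z; decide

theorem unitExp_four (u : ℤ) : unitExp 4 u = Complex.I ^ u := by
  have h : Complex.I = Complex.exp (Real.pi / 2 * Complex.I) := Complex.exp_pi_div_two_mul_I.symm
  rw [h, ← Complex.exp_int_mul, unitExp]; congr 1; push_cast; ring

theorem I_zpow_congr {m k : ℤ} (h : m ≡ k [ZMOD 4]) : Complex.I ^ m = Complex.I ^ k := by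
  rw [← unitExp_four, ← unitExp_four]; exact unitExp_congr (by norm_num) h

theorem unitExp_eight_one : unitExp 8 1 = (Real.sqrt 2 / 2 : ℝ) * (1 + Complex.I) := by
  rw [unitExp, show (2 * Real.pi * Complex.I * ((1 : ℤ) / (8 : ℕ)) : ℂ)
    = ((Real.pi / 4 : ℝ) : ℂ) * Complex.I by push_cast; ring, Complex.exp_mul_I,
    ← Complex.ofReal_cos, ← Complex.ofReal_sin, Real.cos_pi_div_four, Real.sin_pi_div_four]
  ring

/-- The sum of modulus $8$ is $4e(u/8)$; this brings it to the same shape as the sum $2(1+i^u)$ of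
modulus $4$. The check runs over the odd classes modulo $8$. -/
theorem two_mul_unitExp_eight {u : ℤ} (hu : Odd u) :
    2 * unitExp 8 u = (Real.sqrt 2 : ℝ) * kroneckerTwo u * (1 + Complex.I ^ u) := by
  have hs : ((Real.sqrt 2 : ℝ) : ℂ) ^ 2 = 2 := by
    rw [← Complex.ofReal_pow, Real.sq_sqrt (by norm_num)]; simp
  have hI := Complex.I_sq
  have hχ : ∀ r : ℕ, u ≡ r [ZMOD 8] →
      2 * unitExp 8 u = 2 * ((Real.sqrt 2 / 2 : ℝ) * (1 + Complex.I)) ^ r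
      ∧ kroneckerTwo u = ZMod.χ₈ (r : ZMod 8) ∧ Complex.I ^ u = Complex.I ^ r := by
    intro r hr
    refine ⟨?_, ?_, ?_⟩
    · rw [unitExp_congr (by norm_num) hr, ← unitExp_eight_one, ← unitExp_mul_natCast, one_mul]
    · rw [kroneckerTwo_eq_χ₈ hu, (ZMod.intCast_eq_intCast_iff u r 8).mpr hr]; simp
    · rw [I_zpow_congr (hr.of_mul_left 2), zpow_natCast]
  have hsq : (((Real.sqrt 2 / 2 : ℝ) : ℂ) * (1 + Complex.I)) ^ 2 = Complex.I := by
    push_cast; linear_combination (1 + Complex.I) ^ 2 / 4 * hs + hI / 2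
  have h8 : u ≡ (1 : ℕ) [ZMOD 8] ∨ u ≡ (3 : ℕ) [ZMOD 8] ∨ u ≡ (5 : ℕ) [ZMOD 8] ∨
      u ≡ (7 : ℕ) [ZMOD 8] := by
    obtain ⟨k, rfl⟩ := hu
    simp only [Int.ModEq]; push_cast; omega
  rcases h8 with h | h | h | h <;> obtain ⟨e1, e2, e3⟩ := hχ _ h <;> rw [e1, e2, e3]
  · rw [show ZMod.χ₈ ((1 : ℕ) : ZMod 8) = 1 by decide]
    push_cast; ring
  · rw [show ZMod.χ₈ ((3 : ℕ) : ZMod 8) = -1 by decide, pow_succ, hsq, Complex.I_pow_three]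
    push_cast; linear_combination (Real.sqrt 2 : ℂ) * hI
  · rw [show ZMod.χ₈ ((5 : ℕ) : ZMod 8) = -1 by decide, pow_succ, show 4 = 2 * 2 by rfl, pow_mul,
      hsq, hI, show 5 = 4 + 1 by rfl, pow_succ, Complex.I_pow_four]
    push_cast; ring
  · rw [show ZMod.χ₈ ((7 : ℕ) : ZMod 8) = 1 by decide, pow_succ, show 6 = 2 * 3 by rfl, pow_mul,
      hsq, show 7 = 4 + 3 by rfl, pow_add, Complex.I_pow_four, Complex.I_pow_three]
    push_cast; linear_combination -(Real.sqrt 2 : ℂ) * hI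

theorem isCoprime_two_of_odd {u : ℤ} (hu : Odd u) : IsCoprime u (2 : ℕ) := by
  obtain ⟨k, rfl⟩ := hu
  exact ⟨1, -k, by push_cast; ring⟩

theorem kroneckerTwo_sq {u : ℤ} (hu : Odd u) : (kroneckerTwo u : ℂ) ^ 2 = 1 := by
  have hu' : Odd u.natAbs := Int.natAbs_odd.mpr hu
  have h : IsCoprime (2 : ℤ) (u.natAbs : ℕ) :=
    (isCoprime_two_of_odd (by exact_mod_cast hu' : Odd (u.natAbs : ℤ))).symm
  exact jacobiSym_sq_of_isCoprime h

/-- Moduli $4$ and $8$ start the two-step descent. Modulus $2$ has to be left out: its sum vanishes,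
while $1+i^u\neq0$ for odd $u$. -/
theorem quadraticGaussSum_two_pow {u : ℤ} (hu : Odd u) (m : ℕ) :
    quadraticGaussSum u (2 ^ (m + 2)) = (Real.sqrt ((2 ^ (m + 2) : ℕ) : ℝ) : ℝ) *
      (kroneckerTwo u : ℂ) ^ (m + 2) * (1 + Complex.I ^ u) := by
  have hk := kroneckerTwo_sq hu
  induction m using Nat.twoStepInduction with
  | zero =>
    rw [ofReal_sqrt_pow_add_two, pow_add, hk]
    have h2 := quadraticGaussSum_two_mul (M := 2) (by norm_num) (by norm_num) u
    simp only [Finset.sum_range_succ, Finset.sum_range_zero] at h2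
    norm_num at h2
    simp [h2, unitExp_four]
  | one =>
    have h2 := quadraticGaussSum_two_mul (M := 4) (by norm_num) (by norm_num) u
    have h4 : unitExp 8 (u * 4) = -1 := by
      rw [show unitExp 8 (u * 4) = unitExp 8 4 from unitExp_congr (by norm_num) (by
        obtain ⟨k, rfl⟩ := hu; rw [Int.modEq_iff_dvd]; exact ⟨-k, by push_cast; ring⟩), unitExp,
        show (2 * Real.pi * Complex.I * ((4 : ℤ) / (8 : ℕ)) : ℂ) = Real.pi * Complex.I by
          push_cast; ring, Complex.exp_pi_mul_I]
    have h9 : unitExp 8 (u * 9) = unitExp 8 u := unitExp_congr (by norm_num) (by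
        rw [Int.modEq_iff_dvd]; exact ⟨-u, by push_cast; ring⟩)
    simp only [Finset.sum_range_succ, Finset.sum_range_zero] at h2
    norm_num at h2
    rw [h4, h9] at h2
    have h8 := two_mul_unitExp_eight hu
    have e8 : 2 ^ (1 + 2) = 8 := by norm_num
    rw [ofReal_sqrt_pow_add_two, pow_add (kroneckerTwo u : ℂ), hk, e8, h2]
    push_cast
    rw [mul_one]
    linear_combination 2 * h8
  | more m ih _ =>
    rw [quadraticGaussSum_two_pow_add_four m (isCoprime_two_of_odd hu), ih,
      ofReal_sqrt_pow_add_two 2 (m + 2),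
      pow_add _ (m + 2) 2, hk]
    push_cast; ring

/-! ### Double Gauss sums: diagonalisation and descent -/

theorem doubleGaussSum_eq (a b c S : ℤ) (k : ℕ) :
    doubleGaussSum a b c S k = ∑ x ∈ Finset.range k, ∑ y ∈ Finset.range k,
      unitExp k (S * (a * (x : ℤ) ^ 2 + b * (x : ℤ) * (y : ℤ) + c * (y : ℤ) ^ 2)) := rfl

/-- Completing the square splits a double Gauss sum into two quadratic Gauss sums. -/
theorem doubleGaussSum_eq_mul {N : ℕ} (hN : N ≠ 0) {a b c S u v w E : ℤ} (hv : IsCoprime v N)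
    (h : ∀ x y : ℤ, S * (a * x ^ 2 + b * x * y + c * y ^ 2) ≡
      u * ((v * x + w * y) ^ 2 + E * y ^ 2) [ZMOD N]) :
    doubleGaussSum a b c S N = quadraticGaussSum u N * quadraticGaussSum (u * E) N := by
  rw [doubleGaussSum_eq, Finset.sum_comm, quadraticGaussSum, quadraticGaussSum, Finset.mul_sum]
  refine Finset.sum_congr rfl fun y _ => ?_
  have hg : ∀ m k : ℤ, m ≡ k [ZMOD N] → unitExp N (u * m ^ 2) = unitExp N (u * k ^ 2) :=
    fun m k hmk => unitExp_congr hN ((hmk.pow 2).mul_left u)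
  -- For fixed $y$, the substitution $x\mapsto vx+wy$ permutes the residues, so the inner sum no
  -- longer depends on $y$.
  rw [← sum_range_affine hN (g := fun m => unitExp N (u * m ^ 2)) hg hv (w * y), Finset.sum_mul]
  refine Finset.sum_congr rfl fun x _ => ?_
  rw [← unitExp_add]
  exact unitExp_congr hN ((h x y).trans (by ring_nf; rfl))

/-- A shift of $y$ by $pM$ twists by $e(Sbxt/p)$, since $p\mid 2c$ removes the other cross term;
this forces $p\mid x$. A shift of such an $x$ then twists by $e(Sbyt/p)$ whatever $a$ is, and forces
$p\mid y$. Asking only $p\mid 2c$ admits odd $c$ at $p=2$. -/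
theorem doubleGaussSum_mul_mul {p : ℕ} (hp : p ≠ 0) {M : ℕ} (hM : M ≠ 0) {a b c S : ℤ}
    (hb : IsCoprime (S * b) p) (hc : (p : ℤ) ∣ 2 * c) :
    doubleGaussSum a b c S (p * (p * M)) = p ^ 2 * doubleGaussSum a b c S M := by
  have hN : p * (p * M) ≠ 0 := by positivity
  obtain ⟨c', hc'⟩ := hc
  have hlift : ∀ m : ℤ, unitExp p m = unitExp (p * (p * M)) (p * M * m) := by
    intro m
    rw [← unitExp_mul_left (mul_ne_zero hp hM)]
    push_cast
    congr 1; ring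
  set F : ℤ → ℤ → ℂ := fun x y =>
    unitExp (p * (p * M)) (S * (a * x ^ 2 + b * x * y + c * y ^ 2)) with hF
  have hy : ∀ x : ℕ, ∑ y ∈ Finset.range (p * (p * M)), F x y =
      if p ∣ x then ∑ y ∈ Finset.range (p * (p * M)), F x y else 0 := by
    intro x
    split_ifs with hx
    · rfl
    rw [sum_range_mul_of_twist hp (p * M) (k := fun _ => S * b * x)]
    · simp_rw [natCast_dvd_mul_of_isCoprime hb]
      simp [hx]
    · intro y t
      rw [hlift, hF, ← unitExp_add]
      refine unitExp_congr hN ?_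
      rw [Int.modEq_iff_dvd]
      refine ⟨-(S * (c' * y * t + c * M * t ^ 2)), ?_⟩
      push_cast
      linear_combination (-(S * p * M * y * t) : ℤ) * hc'
  have hx : ∀ y : ℕ, ∑ x ∈ Finset.range (p * M), F (p * x : ℕ) y =
      if p ∣ y then ∑ x ∈ Finset.range (p * M), F (p * x : ℕ) y else 0 := by
    intro y
    split_ifs with hy
    · rfl
    rw [sum_range_mul_of_twist hp M (k := fun _ => S * b * y)]
    · simp_rw [natCast_dvd_mul_of_isCoprime hb]
      simp [hy]
    · intro x t
      rw [hlift, hF, ← unitExp_add]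
      refine unitExp_congr hN ?_
      rw [Int.modEq_iff_dvd]
      refine ⟨-(S * a * (2 * x * t + M * t ^ 2)), ?_⟩
      push_cast
      ring
  have hFF : ∀ x y : ℕ, F (p * x : ℕ) (p * y : ℕ) =
      unitExp M (S * (a * (x : ℤ) ^ 2 + b * (x : ℤ) * (y : ℤ) + c * (y : ℤ) ^ 2)) := by
    intro x y
    rw [← unitExp_mul_left hp M, ← unitExp_mul_left hp (p * M), hF]
    push_cast
    congr 1; ring
  rw [doubleGaussSum_eq, doubleGaussSum_eq]
  change ∑ x ∈ Finset.range (p * (p * M)), ∑ y ∈ Finset.range (p * (p * M)), F x y = _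
  rw [Finset.sum_congr rfl fun x _ => hy x,
    sum_range_mul_ite_dvd hp (p * M) fun x => ∑ y ∈ Finset.range (p * (p * M)), F x y,
    Finset.sum_comm, Finset.sum_congr rfl fun y _ => hx y,
    sum_range_mul_ite_dvd hp (p * M) fun y => ∑ x ∈ Finset.range (p * M), F (p * x : ℕ) y]
  simp_rw [hFF]
  rw [Finset.sum_comm, sum_range_mul_periodic, sq, mul_assoc]
  · congr 1
    rw [Finset.mul_sum]
    refine Finset.sum_congr rfl fun x _ => ?_
    refine sum_range_mul_periodic _ _ fun y t => unitExp_congr hM ?_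
    rw [Int.modEq_iff_dvd]
    exact ⟨-(S * (b * x * t + c * (2 * y * t + M * t ^ 2))), by push_cast; ring⟩
  · intro x t
    refine Finset.sum_congr rfl fun y _ => unitExp_congr hM ?_
    rw [Int.modEq_iff_dvd]
    exact ⟨-(S * (b * y * t + a * (2 * x * t + M * t ^ 2))), by push_cast; ring⟩

theorem doubleGaussSum_modulus_one (a b c S : ℤ) : doubleGaussSum a b c S 1 = 1 := by
  simp [doubleGaussSum_eq]

/-- The double Gauss sum of a form that splits into a hyperbolic plane over the `p`-adic integers. -/
theorem doubleGaussSum_prime_pow_of_dvd {p : ℕ} (hp : p ≠ 0) {a b c S : ℤ}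
    (hb : IsCoprime (S * b) p) (hc : (p : ℤ) ∣ c) (n : ℕ) :
    doubleGaussSum a b c S (p ^ n) = p ^ n := by
  induction n using Nat.twoStepInduction with
  | zero => simp [doubleGaussSum_modulus_one]
  | one =>
    -- As $p\mid c$, the phase is linear in $y$ modulo $p$, so summing over $y$ leaves only $x=0$.
    have hy : ∀ x : ℕ, ∑ y ∈ Finset.range (p * 1),
        unitExp p (S * (a * (x : ℤ) ^ 2 + b * (x : ℤ) * (y : ℤ) + c * (y : ℤ) ^ 2)) =
        if p ∣ x then p * unitExp p (S * a * (x : ℤ) ^ 2) else 0 := by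
      intro x
      rw [sum_range_mul_of_twist hp 1 (k := fun _ => S * b * x)]
      · simp_rw [natCast_dvd_mul_of_isCoprime hb]
        split_ifs <;> simp [mul_assoc]
      · intro y t
        rw [← unitExp_add]
        refine unitExp_congr hp ?_
        obtain ⟨c', rfl⟩ := hc
        rw [Int.modEq_iff_dvd]
        exact ⟨-(S * c' * (2 * y * t + t ^ 2)), by push_cast; ring⟩
    simp only [mul_one] at hy
    have h1 := sum_range_mul_ite_dvd hp 1 fun x => (p : ℂ) * unitExp p (S * a * (x : ℤ) ^ 2)
    rw [mul_one] at h1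
    rw [doubleGaussSum_eq, pow_one, Finset.sum_congr rfl fun x _ => hy x, h1]
    simp
  | more n ih _ =>
    rw [show p ^ (n + 2) = p * (p * p ^ n) by ring,
      doubleGaussSum_mul_mul hp (pow_ne_zero _ hp) hb (hc.mul_left 2), ih]
    ring

theorem unitExp_two_of_even {m : ℤ} (hm : Even m) : unitExp 2 m = 1 :=
  (unitExp_eq_one_iff two_ne_zero m).mpr hm.two_dvd

theorem unitExp_two_of_odd {m : ℤ} (hm : Odd m) : unitExp 2 m = -1 := by
  obtain ⟨k, rfl⟩ := hm
  rw [unitExp_add, unitExp_two_of_even (even_two_mul k), one_mul, unitExp,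
    ← Complex.exp_pi_mul_I]
  congr 1; push_cast; ring

theorem doubleGaussSum_modulus_two (a b c S : ℤ) :
    doubleGaussSum a b c S 2 =
      1 + unitExp 2 (S * c) + (unitExp 2 (S * a) + unitExp 2 (S * (a + b + c))) := by
  simp [doubleGaussSum_eq, Finset.sum_range_succ]

/-- This is the anisotropic unimodular plane over the $2$-adic integers. Modulus $2$ gives
$1-1-1-1=-2$, and each descent multiplies by $4=(-2)^2$. -/
theorem doubleGaussSum_two_pow_of_odd {a b c S : ℤ} (ha : Odd a) (hb : Odd b) (hc : Odd c)
    (hS : Odd S) (n : ℕ) : doubleGaussSum a b c S (2 ^ n) = (-2) ^ n := by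
  induction n using Nat.twoStepInduction with
  | zero => simp [doubleGaussSum_modulus_one]
  | one =>
    rw [pow_one, doubleGaussSum_modulus_two, unitExp_two_of_odd (hS.mul hc),
      unitExp_two_of_odd (hS.mul ha), unitExp_two_of_odd (hS.mul ((ha.add_odd hb).add_odd hc))]
    norm_num
  | more n ih _ =>
    rw [show 2 ^ (n + 2) = 2 * (2 * 2 ^ n) by ring, doubleGaussSum_mul_mul two_ne_zero
      (by positivity) (isCoprime_two_of_odd (hS.mul hb)) (dvd_mul_right _ _), ih]
    push_cast; ring

/-! ### Evaluation at odd primes -/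

theorem sqrt_natCast_pow (p k : ℕ) : Real.sqrt ((p ^ k : ℕ) : ℝ) = (p : ℝ) ^ ((k : ℝ) / 2) := by
  rw [Real.sqrt_eq_rpow, Nat.cast_pow, ← Real.rpow_natCast, ← Real.rpow_mul (by positivity)]
  congr 1; ring

theorem quadraticGaussSum_mul_of_modEq {p : ℕ} (hp : p ≠ 0) {d m : ℕ} {u E D : ℤ}
    (hE : E ≡ (p : ℤ) ^ d * D [ZMOD (p : ℤ) ^ (d + m)]) :
    quadraticGaussSum (u * E) (p ^ (d + m)) = (p : ℂ) ^ d * quadraticGaussSum (u * D) (p ^ m) := by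
  have h : u * E ≡ (p ^ d : ℕ) * (u * D) [ZMOD (p ^ (d + m) : ℕ)] := by
    push_cast
    exact (hE.mul_left u).trans (by rw [mul_left_comm])
  rw [quadraticGaussSum_congr (pow_ne_zero _ hp) h, pow_add,
    quadraticGaussSum_mul_left (pow_ne_zero _ hp) (pow_ne_zero _ hp)]
  push_cast; rfl

theorem exists_mul_modEq {a : ℤ} {N : ℕ} (ha : IsCoprime a N) (S : ℤ) :
    ∃ u : ℤ, u * a ≡ S [ZMOD N] := by
  obtain ⟨r, s, h⟩ := ha
  refine ⟨S * r, ?_⟩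
  rw [Int.modEq_iff_dvd]
  exact ⟨S * s, by linear_combination -S * h⟩

theorem jacobiSym_eq_of_mul_modEq {p : ℕ} {u a S : ℤ} (ha : IsCoprime a p)
    (h : u * a ≡ S [ZMOD p]) : jacobiSym u p = jacobiSym (S * a) p := by
  have h1 : jacobiSym (S * a) p = jacobiSym (u * a * a) p :=
    jacobiSym.mod_left' (h.symm.mul_right a)
  rw [h1, jacobiSym.mul_left, jacobiSym.mul_left, mul_assoc, ← sq,
    jacobiSym.sq_one (Int.isCoprime_iff_gcd_eq_one.mp ha), mul_one]

/-- Each one-variable sum brings a factor $\varepsilon$. A sign $i\cdot i=-1$ appears beyond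
$\varepsilon_{p^\delta}$ exactly when $p\equiv3$ modulo $4$, $\delta$ is even and $m$ is odd, which
is when $(-1/p)^{(\delta+m)(\delta+1)}=-1$. -/
theorem I_pow_sq_half_mul {p : ℕ} (hp : Odd p) (δ m : ℕ) :
    Complex.I ^ (((p ^ (δ + m) - 1) / 2) ^ 2) * Complex.I ^ (((p ^ m - 1) / 2) ^ 2) =
      (jacobiSym (-1) p : ℂ) ^ ((δ + m) * (δ + 1)) * Complex.I ^ (((p ^ δ - 1) / 2) ^ 2) := by
  have h4 : p % 4 = 1 ∨ p % 4 = 3 := by obtain ⟨k, rfl⟩ := hp; omega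
  rw [jacobiSym.at_neg_one hp]
  rcases h4 with h | h
  · have hk : ∀ k, p ^ k % 4 = 1 := by intro k; simp [Nat.pow_mod, h]
    rw [I_pow_sq_half (hk _), I_pow_sq_half (hk _), I_pow_sq_half (hk _),
      ZMod.χ₄_nat_one_mod_four h]
    simp
  · have he : ∀ k, Even k → Complex.I ^ (((p ^ k - 1) / 2) ^ 2) = 1 := by
      rintro k ⟨j, rfl⟩
      refine I_pow_sq_half ?_
      rw [← two_mul, pow_mul, Nat.pow_mod, Nat.pow_mod p, h]
      norm_num
    have ho : ∀ k, Odd k → Complex.I ^ (((p ^ k - 1) / 2) ^ 2) = Complex.I := by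
      rintro k ⟨j, rfl⟩
      refine I_pow_sq_half' ?_
      rw [pow_succ, pow_mul, Nat.mul_mod, Nat.pow_mod, Nat.pow_mod p, h]
      norm_num
    rw [ZMod.χ₄_nat_three_mod_four h]
    push_cast
    rcases Nat.even_or_odd δ with hd | hd <;> rcases Nat.even_or_odd m with hm | hm
    · rw [he _ (hd.add hm), he _ hm, he _ hd, ((hd.add hm).mul_right _).neg_one_pow]
    · rw [ho _ (hd.add_odd hm), ho _ hm, he _ hd,
        ((hd.add_odd hm).mul (hd.add_odd odd_one)).neg_one_pow, Complex.I_mul_I, mul_one]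
    · rw [ho _ (hd.add_even hm), he _ hm, ho _ hd,
        ((hd.add_odd odd_one).mul_left _).neg_one_pow, mul_comm]
    · rw [he _ (hd.add_odd hm), ho _ hm, ho _ hd, ((hd.add_odd hm).mul_right _).neg_one_pow]

theorem doubleGaussSum_odd_prime_pow {p : ℕ} (hp : p.Prime) (hp2 : p ≠ 2) {S a b c D : ℤ}
    {δ m : ℕ} (hn : 1 ≤ δ + m) (hS : IsCoprime S p) (ha : IsCoprime a p) (hD : IsCoprime D p)
    (hΔ : 4 * a * c - b ^ 2 ≡ (p : ℤ) ^ δ * D [ZMOD (p : ℤ) ^ (δ + m)]) :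
    doubleGaussSum a b c S (p ^ (δ + m)) =
      (((p : ℝ) ^ (((δ + m : ℕ) : ℝ) + (δ : ℝ) / 2) : ℝ) : ℂ)
        * (jacobiSym (S * a) p : ℂ) ^ δ
        * (jacobiSym D p : ℂ) ^ (δ + m + δ)
        * (jacobiSym (-1) p : ℂ) ^ ((δ + m) * (δ + 1))
        * Complex.I ^ (((p ^ δ - 1) / 2) ^ 2) := by
  have hpos : (0 : ℝ) < p := by exact_mod_cast hp.pos
  have h2 : IsCoprime (2 : ℤ) p := by
    rw [Int.isCoprime_iff_gcd_eq_one]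
    exact (Nat.coprime_primes Nat.prime_two hp).mpr hp2.symm
  have h2a : IsCoprime (2 * a) ((p ^ (δ + m) : ℕ) : ℤ) := by
    push_cast; exact (h2.mul_left ha).pow_right
  have h4a : IsCoprime (2 * 2 * a) p := (h2.mul_left h2).mul_left ha
  have h4aN : IsCoprime (2 * 2 * a) ((p ^ (δ + m) : ℕ) : ℤ) := by
    push_cast; exact h4a.pow_right
  -- $u=S/(4a)$ absorbs the $4a$ of the completed square; $4$ being a square, $u$ has the same
  -- symbol as $Sa$.
  obtain ⟨u, hu⟩ := exists_mul_modEq h4aN S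
  have hup : u * (2 * 2 * a) ≡ S [ZMOD p] := by
    refine hu.of_dvd ?_
    push_cast; exact dvd_pow_self _ (by omega)
  have hJ : jacobiSym u p = jacobiSym (S * a) p := by
    rw [jacobiSym_eq_of_mul_modEq h4a hup, show S * (2 * 2 * a) = S * a * (2 * 2) by ring,
      jacobiSym.mul_left (S * a), jacobiSym.mul_left 2 2, ← sq,
      jacobiSym.sq_one (Int.isCoprime_iff_gcd_eq_one.mp h2), mul_one]
  have huc : IsCoprime u p := by
    have h1 : IsCoprime (u * (2 * 2 * a)) p := by
      obtain ⟨k, hk⟩ := hup.dvd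
      rw [show u * (2 * 2 * a) = S + -k * p by linear_combination -hk]
      exact hS.add_mul_right_left _
    exact h1.of_mul_left_left
  have hdiag := doubleGaussSum_eq_mul (pow_ne_zero (δ + m) hp.ne_zero) (a := a) (b := b) (c := c)
    (S := S) (u := u) (v := 2 * a) (w := b) (E := 4 * a * c - b ^ 2) h2a (by
      intro x y
      have := (hu.mul_right (a * x ^ 2 + b * x * y + c * y ^ 2)).symm
      exact this.trans (by ring_nf; rfl))
  rw [hdiag, quadraticGaussSum_mul_of_modEq hp.ne_zero hΔ,
    quadraticGaussSum_odd_prime_pow hp hp2 huc,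
    quadraticGaussSum_odd_prime_pow hp hp2 (huc.mul_left hD), jacobiSym.mul_left u D, hJ]
  have hJ2 := jacobiSym_sq_of_isCoprime (hS.mul_left ha)
  have hD2 := jacobiSym_sq_of_isCoprime hD
  have hI := I_pow_sq_half_mul (hp.odd_of_ne_two hp2) δ m
  have hpow : (((p : ℝ) ^ (((δ + m : ℕ) : ℝ) + (δ : ℝ) / 2) : ℝ) : ℂ) =
      (Real.sqrt ((p ^ (δ + m) : ℕ) : ℝ) : ℝ) * ((p : ℂ) ^ δ *
        (Real.sqrt ((p ^ m : ℕ) : ℝ) : ℝ)) := by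
    have : (p : ℝ) ^ (((δ + m : ℕ) : ℝ) + (δ : ℝ) / 2) =
        Real.sqrt ((p ^ (δ + m) : ℕ) : ℝ) * ((p : ℝ) ^ δ * Real.sqrt ((p ^ m : ℕ) : ℝ)) := by
      rw [sqrt_natCast_pow, sqrt_natCast_pow, ← Real.rpow_natCast, ← Real.rpow_add hpos,
        ← Real.rpow_add hpos]
      congr 1; push_cast; ring
    rw [this]; push_cast; rfl
  rw [hpow, mul_assoc _ ((jacobiSym (-1) p : ℂ) ^ _), ← hI]
  push_cast
  generalize (jacobiSym (S * a) p : ℂ) = J at *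
  generalize (jacobiSym D p : ℂ) = K at *
  -- The symbols have square $1$, so only parities count: $(\delta+m)+m\sim\delta$ for $J$ and
  -- $m\sim(\delta+m)+\delta$ for $K$.
  have e1 : J ^ (δ + m) * J ^ m = J ^ δ := by
    rw [← pow_add, add_assoc, ← two_mul, pow_add, pow_mul, hJ2, one_pow, mul_one]
  have e2 : K ^ (δ + m + δ) = K ^ m := by
    rw [show δ + m + δ = m + 2 * δ by ring, pow_add, pow_mul, hD2, one_pow, mul_one]
  rw [e2, ← e1, mul_pow]
  ring

/-! ### Evaluation at the prime 2 -/

theorem kroneckerTwo_congr {m k : ℤ} (hm : Odd m) (h : m ≡ k [ZMOD 8]) :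
    kroneckerTwo m = kroneckerTwo k := by
  have hk : Odd k := by
    rw [Int.odd_iff] at hm ⊢
    have : m ≡ k [ZMOD 2] := h.of_dvd (by norm_num)
    rw [← this]; exact hm
  rw [kroneckerTwo_eq_χ₈ hm, kroneckerTwo_eq_χ₈ hk, (ZMod.intCast_eq_intCast_iff m k 8).mpr h]

theorem kroneckerTwo_mul {m k : ℤ} (hm : Odd m) (hk : Odd k) :
    kroneckerTwo (m * k) = kroneckerTwo m * kroneckerTwo k := by
  rw [kroneckerTwo_eq_χ₈ hm, kroneckerTwo_eq_χ₈ hk, kroneckerTwo_eq_χ₈ (hm.mul hk)]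
  push_cast; exact map_mul _ _ _

theorem I_zpow_two_mul_odd {u : ℤ} (hu : Odd u) : Complex.I ^ (2 * u) = -1 := by
  obtain ⟨k, rfl⟩ := hu
  rw [I_zpow_congr (k := 2) (by rw [Int.modEq_iff_dvd]; exact ⟨-k, by ring⟩)]
  exact_mod_cast Complex.I_sq

/-- For $D\equiv1$ modulo $4$ the product is $(1+i^u)^2=2i^u$; for $D\equiv3$ it is
$(1+i^u)(1+i^{-u})=2$. The parity of $(D+1)/2$ tells the two apart. -/
theorem one_add_I_zpow_mul {u D : ℤ} (hu : Odd u) (hD : Odd D) :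
    (1 + Complex.I ^ u) * (1 + Complex.I ^ (u * D)) =
      2 * Complex.I ^ (u * ((D + 1) / 2) ^ 2) := by
  have h2 := I_zpow_two_mul_odd hu
  rw [two_mul, zpow_add₀ Complex.I_ne_zero] at h2
  obtain ⟨k, rfl⟩ := hD
  rw [show (2 * k + 1 + 1) / 2 = k + 1 by omega]
  rcases Int.even_or_odd' k with ⟨j, rfl | rfl⟩
  · rw [I_zpow_congr (m := u * (2 * (2 * j) + 1)) (k := u) (by
      rw [Int.modEq_iff_dvd]; exact ⟨-(u * j), by ring⟩),
      I_zpow_congr (m := u * (2 * j + 1) ^ 2) (k := u) (by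
      rw [Int.modEq_iff_dvd]; exact ⟨-(u * (j ^ 2 + j)), by ring⟩)]
    linear_combination h2
  · rw [I_zpow_congr (m := u * (2 * (2 * j + 1) + 1)) (k := u + u + u) (by
      rw [Int.modEq_iff_dvd]; exact ⟨-(u * j), by ring⟩),
      I_zpow_congr (m := u * (2 * j + 1 + 1) ^ 2) (k := 0) (by
      rw [Int.modEq_iff_dvd]; exact ⟨-(u * (j + 1) ^ 2), by ring⟩),
      zpow_add₀ Complex.I_ne_zero, zpow_add₀ Complex.I_ne_zero, zpow_zero]
    linear_combination (Complex.I ^ u * Complex.I ^ u + Complex.I ^ u - 1) * h2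

/-- An even middle coefficient lets the square be completed after multiplying by the unit $a$ alone,
without the factor $4$. Hence $E=\Delta/4$. -/
theorem doubleGaussSum_two_pow_eq_mul {n : ℕ} (hn : 1 ≤ n) {a b A S : ℤ} (c : ℤ) (hS : Odd S)
    (hA : Odd A) (ha : a ≡ A [ZMOD 2 ^ n]) (hb : Even b) :
    ∃ u E : ℤ, Odd u ∧ u * A ≡ S [ZMOD 2 ^ n] ∧ 4 * E = 4 * a * c - b ^ 2 ∧
      doubleGaussSum a b c S (2 ^ n) =
        quadraticGaussSum u (2 ^ n) * quadraticGaussSum (u * E) (2 ^ n) := by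
  have h2 : (2 : ℤ) ∣ 2 ^ n := dvd_pow_self 2 (by omega)
  have hao : Odd a := by
    rw [Int.odd_iff] at hA ⊢
    rw [← hA]; exact ha.of_dvd h2
  have hac : IsCoprime a ((2 ^ n : ℕ) : ℤ) := by
    push_cast; exact (isCoprime_two_of_odd hao).pow_right
  obtain ⟨u, hu⟩ := exists_mul_modEq hac S
  push_cast at hu
  have huo : Odd u := by
    have h1 : Odd (u * a) := by
      rw [Int.odd_iff] at hS ⊢
      rw [← hS]; exact hu.of_dvd h2
    exact (Int.odd_mul.mp h1).1
  obtain ⟨b', rfl⟩ := even_iff_two_dvd.mp hb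
  refine ⟨u, a * c - b' ^ 2, huo, (ha.symm.mul_left u).trans hu, by ring, ?_⟩
  refine doubleGaussSum_eq_mul (by positivity) (v := a) (w := b') hac fun x y => ?_
  push_cast
  exact ((hu.mul_right (a * x ^ 2 + 2 * b' * x * y + c * y ^ 2)).symm).trans (by ring_nf; rfl)

theorem ofReal_two_rpow_eq {s : ℝ} (k d n : ℕ) (hs : s = (k : ℝ) + (d : ℝ) / 2 + (n : ℝ) / 2) :
    (((2 : ℝ) ^ s : ℝ) : ℂ) = 2 ^ k * ((Real.sqrt ((2 ^ d : ℕ) : ℝ) : ℝ) *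
      (Real.sqrt ((2 ^ n : ℕ) : ℝ) : ℝ)) := by
  have : (2 : ℝ) ^ s = 2 ^ k * (Real.sqrt ((2 ^ d : ℕ) : ℝ) * Real.sqrt ((2 ^ n : ℕ) : ℝ)) := by
    rw [sqrt_natCast_pow, sqrt_natCast_pow, ← Real.rpow_natCast 2 k]
    push_cast
    rw [← Real.rpow_add two_pos, ← Real.rpow_add two_pos, hs]
    congr 1; ring
  rw [this]; push_cast; rfl

theorem kroneckerTwo_eq_of_mul_modEq {u A S : ℤ} (hu : Odd u) (hA : Odd A)
    (h : u * A ≡ S [ZMOD 8]) : kroneckerTwo u = kroneckerTwo (S * A) := by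
  refine kroneckerTwo_congr hu ((h.mul_right A).symm.trans ?_).symm
  obtain ⟨k, hk⟩ := Int.eight_dvd_sq_sub_one_of_odd hA
  rw [Int.modEq_iff_dvd]
  exact ⟨-(u * k), by linear_combination -u * hk⟩

theorem modEq_four_of_mul_modEq {u A S : ℤ} (hA : Odd A) (h : u * A ≡ S [ZMOD 4]) :
    u ≡ S * A [ZMOD 4] := by
  refine ((h.mul_right A).symm.trans ?_).symm
  obtain ⟨k, rfl⟩ := hA
  rw [Int.modEq_iff_dvd]
  exact ⟨-(u * (k ^ 2 + k)), by ring⟩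

theorem quadraticGaussSum_zero {N : ℕ} : quadraticGaussSum 0 N = N := by
  simp [quadraticGaussSum]

theorem quadraticGaussSum_two {u : ℤ} (hu : Odd u) : quadraticGaussSum u 2 = 0 := by
  simp [quadraticGaussSum, Finset.sum_range_succ, unitExp_two_of_odd hu]

/-- The `2`-adic evaluation for a form with even middle coefficient and odd leading coefficient. -/
theorem doubleGaussSum_two_pow_of_even {n : ℕ} (hn : 2 ≤ n) {a b c A S D : ℤ} {δ : ℕ} (hS : Odd S)
    (hA : Odd A) (ha : a ≡ A [ZMOD 2 ^ n]) (hb : Even b) (hD : Odd D)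
    (hΔ : 4 * a * c - b ^ 2 ≡ 2 ^ δ * D [ZMOD 2 ^ (n + 2)]) :
    (δ = n + 2 → doubleGaussSum a b c S (2 ^ n) =
      (((2 : ℝ) ^ ((3 * (n : ℝ)) / 2) : ℝ) : ℂ) * (kroneckerTwo (S * A) : ℂ) ^ δ
        * (1 + Complex.I ^ (S * A))) ∧
    (δ = n + 1 → doubleGaussSum a b c S (2 ^ n) = 0) ∧
    (δ ≤ n → doubleGaussSum a b c S (2 ^ n) =
      (((2 : ℝ) ^ ((n : ℝ) + (δ : ℝ) / 2) : ℝ) : ℂ) * (kroneckerTwo (S * A) : ℂ) ^ δ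
        * (kroneckerTwo D : ℂ) ^ (n + δ) * Complex.I ^ (S * A * ((D + 1) / 2) ^ 2)) := by
  obtain ⟨u, E, hu, huA, hE, hG⟩ := doubleGaussSum_two_pow_eq_mul (by omega) c hS hA ha hb
  have hk2 := kroneckerTwo_sq (hS.mul hA)
  have hku2 := kroneckerTwo_sq hu
  have hkD2 := kroneckerTwo_sq hD
  -- $\Delta=4E$ while $D$ is odd. With $\delta=d+2$, knowing $\Delta$ modulo $2^{n+2}$ is knowing
  -- $E\equiv2^dD$ modulo $2^n$.
  have hδ : 2 ≤ δ := by
    by_contra hlt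
    have h4 : (4 : ℤ) ∣ 2 ^ δ * D := by
      have h1 : (4 : ℤ) ∣ 2 ^ (n + 2) := ⟨2 ^ n, by ring⟩
      exact ((Int.ModEq.dvd_iff (hΔ.of_dvd h1)).mp ⟨E, hE.symm⟩)
    obtain ⟨k, rfl⟩ := hD
    obtain h | h : δ = 0 ∨ δ = 1 := by omega
    all_goals subst h; omega
  obtain ⟨d, rfl⟩ := Nat.exists_eq_add_of_le' hδ
  have hEd : E ≡ 2 ^ d * D [ZMOD 2 ^ n] := by
    rw [← hE, Int.modEq_iff_dvd] at hΔ
    obtain ⟨k, hk⟩ := hΔ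
    rw [Int.modEq_iff_dvd]
    refine ⟨k, ?_⟩
    have : 4 * (2 ^ d * D - E) = 4 * (2 ^ n * k) := by rw [pow_add, pow_add] at hk; linarith
    linarith
  have hI4 : u ≡ S * A [ZMOD 4] :=
    modEq_four_of_mul_modEq hA (huA.of_dvd ⟨2 ^ (n - 2), by
      rw [show (4 : ℤ) = 2 ^ 2 by norm_num, ← pow_add]; congr 1; omega⟩)
  -- The symbol needs $u$ modulo $8$, which is not available for $n=2$; in the uses below the
  -- exponents are then even.
  have hk8 : 3 ≤ n → kroneckerTwo u = kroneckerTwo (S * A) := fun h3 =>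
    kroneckerTwo_eq_of_mul_modEq hu hA (huA.of_dvd ⟨2 ^ (n - 3), by
      rw [show (8 : ℤ) = 2 ^ 3 by norm_num, ← pow_add]; congr 1; omega⟩)
  obtain ⟨k, rfl⟩ := Nat.exists_eq_add_of_le' hn
  rw [quadraticGaussSum_two_pow hu, I_zpow_congr hI4] at hG
  -- The second factor has $E\equiv0$ (a sum of ones), or reduces to modulus $2$ (zero), or reduces
  -- to a modulus at least $4$.
  refine ⟨fun h => ?_, fun h => ?_, fun h => ?_⟩
  · have hd : d = k + 2 := by omega
    subst hd
    have hE0 : u * E ≡ 0 [ZMOD ((2 ^ (k + 2) : ℕ) : ℤ)] := by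
      push_cast
      have := (hEd.mul_left u).trans (Int.modEq_zero_iff_dvd.mpr ⟨u * D, by ring⟩)
      exact this
    have hkk : (kroneckerTwo (S * A) : ℂ) ^ (k + 2 + 2) = (kroneckerTwo u : ℂ) ^ (k + 2) := by
      rw [pow_add _ (k + 2) 2, hk2, mul_one]
      rcases Nat.eq_zero_or_pos k with h0 | h0
      · subst h0; rw [zero_add, hk2, hku2]
      · rw [hk8 (by omega)]
    rw [hG, quadraticGaussSum_congr (by positivity) hE0, quadraticGaussSum_zero, hkk,
      ofReal_two_rpow_eq (k + 2) (k + 2) 0 (by push_cast; ring)]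
    simp
    ring
  · have hd : d = k + 1 := by omega
    subst hd
    have := quadraticGaussSum_mul_of_modEq two_ne_zero (d := k + 1) (m := 1) (u := u) hEd
    rw [hG, this, pow_one, quadraticGaussSum_two (hu.mul hD), mul_zero, mul_zero]
  · obtain ⟨m, rfl⟩ : ∃ m, k = d + m := Nat.exists_eq_add_of_le (by omega)
    have := quadraticGaussSum_mul_of_modEq two_ne_zero (d := d) (m := m + 2) (u := u) hEd
    rw [add_assoc d m 2] at hG ⊢
    rw [hG, this, quadraticGaussSum_two_pow (hu.mul hD), kroneckerTwo_mul hu hD,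
      I_zpow_congr (hI4.mul_right D),
      ofReal_two_rpow_eq (d + 1) (d + (m + 2)) (m + 2) (by push_cast; ring)]
    have hI := one_add_I_zpow_mul (hS.mul hA) hD
    have hkk : (kroneckerTwo (S * A) : ℂ) ^ (d + 2) =
        (kroneckerTwo u : ℂ) ^ (d + (m + 2)) * (kroneckerTwo u : ℂ) ^ (m + 2) := by
      rw [pow_add _ d 2, hk2, ← pow_add, add_assoc d, ← two_mul, pow_add, pow_mul, hku2, one_pow]
      rcases Nat.eq_zero_or_pos d with h0 | h0
      · subst h0; simp
      · rw [hk8 (by omega)]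
    have hDD : (kroneckerTwo D : ℂ) ^ (d + (m + 2) + (d + 2)) = (kroneckerTwo D : ℂ) ^ (m + 2) := by
      rw [show d + (m + 2) + (d + 2) = m + 2 + 2 * (d + 1) by ring, pow_add, pow_mul, hkD2,
        one_pow, mul_one]
    rw [hkk, hDD]
    push_cast
    rw [mul_pow, pow_succ (2 : ℂ) d]
    linear_combination (2 ^ d * (Real.sqrt (2 ^ (d + (m + 2))) : ℂ) * (Real.sqrt (2 ^ (m + 2)) : ℂ) *
      (kroneckerTwo u : ℂ) ^ (d + (m + 2)) * (kroneckerTwo u : ℂ) ^ (m + 2) *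
      (kroneckerTwo D : ℂ) ^ (m + 2)) * hI

/-- The `2`-adic evaluation for a form with odd middle coefficient. -/
theorem doubleGaussSum_two_pow_of_odd_middle {n : ℕ} {a b c S D : ℤ} (k : ℤ)
    (hS : Odd S) (hb : Odd b) (hac : Odd a ∨ Even c) {l : ℕ} (hl : n = l ∨ Even c)
    (hΔ : 4 * a * c - b ^ 2 ≡ D [ZMOD 8]) :
    doubleGaussSum a b c S (2 ^ n) =
      2 ^ n * (kroneckerTwo D : ℂ) ^ l * Complex.I ^ (k * ((D + 1) / 2) ^ 2) := by
  obtain ⟨j, hj⟩ := Int.eight_dvd_sq_sub_one_of_odd hb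
  -- With $b$ odd, $D\equiv\Delta\equiv3$ modulo $4$, so $(D+1)/2$ is even and the power of $i$ is
  -- trivial for every $k$.
  have hI : ∀ i : ℤ, D = 4 * i + 3 → Complex.I ^ (k * ((D + 1) / 2) ^ 2) = 1 := by
    rintro i rfl
    rw [show (4 * i + 3 + 1) / 2 = 2 * (i + 1) by omega, I_zpow_congr (k := 0) (by
      rw [Int.modEq_iff_dvd]; exact ⟨-(k * (i + 1) ^ 2), by ring⟩), zpow_zero]
  obtain ⟨t, ht⟩ := hΔ.dvd
  rcases Int.even_or_odd c with hc | hc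
  · obtain ⟨s, hs⟩ : (8 : ℤ) ∣ 4 * a * c := by
      obtain ⟨i, rfl⟩ := hc
      exact ⟨a * i, by ring⟩
    -- $c$ even gives $D\equiv7$ modulo $8$ and $(2/D)=1$, so the exponent $l$ is immaterial.
    have hD : D = 4 * (2 * (s - j + t) - 1) + 3 := by linear_combination ht + hs - hj
    rw [hI _ hD, doubleGaussSum_prime_pow_of_dvd two_ne_zero
      (isCoprime_two_of_odd (hS.mul hb)) hc.two_dvd]
    have : kroneckerTwo D = kroneckerTwo 7 := by
      refine kroneckerTwo_congr ⟨4 * (s - j + t) - 1, by rw [hD]; ring⟩ ?_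
      rw [hD, Int.modEq_iff_dvd]
      exact ⟨-(s - j + t) + 1, by ring⟩
    rw [this, kroneckerTwo_eq_χ₈ (by decide), show ZMod.χ₈ ((7 : ℤ) : ZMod 8) = 1 by decide]
    simp
  · have ha : Odd a := hac.resolve_right (Int.not_even_iff_odd.mpr hc)
    have hl' : n = l := hl.resolve_right (Int.not_even_iff_odd.mpr hc)
    subst hl'
    obtain ⟨s, hs⟩ := ha.mul hc
    -- $a,c$ odd give $D\equiv3$ modulo $8$ and $(2/D)=-1$, which accounts for the sign of $(-2)^n$.
    have hD : D = 4 * (2 * (s - j + t)) + 3 := by linear_combination ht + 4 * hs - hj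
    rw [hI _ hD, doubleGaussSum_two_pow_of_odd ha hb hc hS]
    have : kroneckerTwo D = kroneckerTwo 3 := by
      refine kroneckerTwo_congr ⟨4 * (s - j + t) + 1, by rw [hD]; ring⟩ ?_
      rw [hD, Int.modEq_iff_dvd]
      exact ⟨-(s - j + t), by ring⟩
    rw [this, kroneckerTwo_eq_χ₈ (by decide), show ZMod.χ₈ ((3 : ℤ) : ZMod 8) = -1 by decide,
      neg_pow]
    push_cast; ring

/-! ### Assembly: cases on α and on the parity of b -/

theorem corollary3p1 (p n : ℕ) (hp : p.Prime) (hn : 1 ≤ n)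
    (S : ℤ) (hS : IsCoprime S (p : ℤ))
    (a b c : ℤ) (habc : Int.gcd (Int.gcd a b) c = 1)
    (α β : ℕ) (A B : ℤ) (hAB : ¬ (p : ℤ) ∣ A * B)
    (ha : a ≡ (p : ℤ) ^ α * A [ZMOD (p : ℤ) ^ n])
    (hb : b ≡ (p : ℤ) ^ β * B [ZMOD (p : ℤ) ^ n])
    (hc : c ≡ 0 [ZMOD (p : ℤ) ^ α])
    (hα : α ≤ n) :
    -- odd `p`
    (p ≠ 2 → ∀ (δ : ℕ) (D : ℤ), ¬ (p : ℤ) ∣ D → δ ≤ n + α →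
      4 * a * c - b ^ 2 ≡ (p : ℤ) ^ δ * D [ZMOD (p : ℤ) ^ (n + α)] →
      doubleGaussSum a b c S (p ^ n) =
        (((p : ℝ) ^ ((n : ℝ) + (δ : ℝ) / 2) : ℝ) : ℂ)
          * (jacobiSym (S * A) p : ℂ) ^ δ
          * (jacobiSym D p : ℂ) ^ (n + α + δ)
          * (jacobiSym (-1) p : ℂ) ^ ((n + α) * (δ + 1))
          * Complex.I ^ (((p ^ δ - 1) / 2) ^ 2)) ∧
    -- `p = 2` and `α + 1 < n`
    (p = 2 → α + 1 < n → ∀ (δ : ℕ) (D : ℤ), ¬ (2 : ℤ) ∣ D →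
      4 * a * c - b ^ 2 ≡ 2 ^ δ * D [ZMOD 2 ^ (n + α + 2)] →
      (δ = n + α + 2 →
        doubleGaussSum a b c S (2 ^ n) =
          (((2 : ℝ) ^ ((3 * (n : ℝ) + (α : ℝ)) / 2) : ℝ) : ℂ)
            * (kroneckerTwo (S * A) : ℂ) ^ δ
            * (1 + Complex.I ^ (S * A))) ∧
      (δ = n + α + 1 → doubleGaussSum a b c S (2 ^ n) = 0) ∧
      (δ ≤ n + α →
        doubleGaussSum a b c S (2 ^ n) =
          (((2 : ℝ) ^ ((n : ℝ) + (δ : ℝ) / 2) : ℝ) : ℂ)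
            * (kroneckerTwo (S * A) : ℂ) ^ δ
            * (kroneckerTwo D : ℂ) ^ (n + α + δ)
            * Complex.I ^ (S * A * ((D + 1) / 2) ^ 2))) ∧
    -- `p = 2` and `α + 1 ≥ n`
    (p = 2 → n ≤ α + 1 →
      (1 < n → doubleGaussSum a b c S (2 ^ n) = 2 ^ n) ∧
      (n = 1 → doubleGaussSum a b c S (2 ^ n) = (-1 : ℂ) ^ c * (1 + (-1 : ℂ) ^ (b + 1)))) := by
  have hpZ : Prime (p : ℤ) := Nat.prime_iff_prime_int.mp hp
  have hA : ¬ (p : ℤ) ∣ A := fun h => hAB (h.mul_right B)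
  have hcop : ∀ m : ℤ, ¬ (p : ℤ) ∣ m → IsCoprime m p := fun m hm =>
    (hpZ.coprime_iff_not_dvd.mpr hm).symm
  have hpn : (p : ℤ) ∣ (p : ℤ) ^ n := dvd_pow_self _ (by omega)
  -- a positive `α` forces `p` to divide `a` and `c` but not `b`
  have hpos : α ≠ 0 → (p : ℤ) ∣ a ∧ (p : ℤ) ∣ c ∧ ¬ (p : ℤ) ∣ b := by
    intro h0
    have hα : (p : ℤ) ∣ (p : ℤ) ^ α := dvd_pow_self _ h0
    have hpa : (p : ℤ) ∣ a := (Int.ModEq.dvd_iff (ha.of_dvd hpn)).mpr (hα.mul_right A)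
    have hpc : (p : ℤ) ∣ c := hα.trans (Int.modEq_zero_iff_dvd.mp hc)
    refine ⟨hpa, hpc, fun hpb => hpZ.not_isUnit ?_⟩
    have := Int.dvd_coe_gcd (Int.dvd_coe_gcd hpa hpb) hpc
    rw [habc] at this
    exact isUnit_of_dvd_one (by exact_mod_cast this)
  have hzero : α = 0 → ¬ (p : ℤ) ∣ a := by
    rintro rfl hpa
    rw [pow_zero, one_mul] at ha
    exact hA ((Int.ModEq.dvd_iff (ha.of_dvd hpn)).mp hpa)
  refine ⟨?_, ?_, ?_⟩
  · intro hp2 δ D hD hδ hΔ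
    rcases eq_or_ne α 0 with h0 | h0
    · subst h0
      rw [add_zero] at hδ hΔ ⊢
      obtain ⟨m, rfl⟩ := Nat.exists_eq_add_of_le hδ
      have haA : jacobiSym (S * a) p = jacobiSym (S * A) p := by
        rw [pow_zero, one_mul] at ha
        exact jacobiSym.mod_left' ((ha.of_dvd hpn).mul_left S)
      rw [doubleGaussSum_odd_prime_pow hp hp2 hn hS (hcop a (hzero rfl)) (hcop D hD) hΔ, haA]
    · obtain ⟨hpa, hpc, hpb⟩ := hpos h0
      have hΔp := hΔ.of_dvd (dvd_pow_self (p : ℤ) (by omega : n + α ≠ 0))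
      have hδ0 : δ = 0 := by
        by_contra hδ0
        have h1 := (Int.ModEq.dvd_iff hΔp).mpr ((dvd_pow_self (p : ℤ) hδ0).mul_right D)
        have h2 : (p : ℤ) ∣ b ^ 2 := (dvd_sub_right (hpc.mul_left (4 * a))).mp h1
        exact hpb (hpZ.dvd_of_dvd_pow h2)
      subst hδ0
      -- Modulo $p$, $D\equiv-b^2$. The two symbols in the formula thus merge into
      -- $(-1/p)^{2(n+\alpha)}=1$, leaving $p^n$.
      have hJ : jacobiSym D p = jacobiSym (-1) p := by
        have h1 : D ≡ -1 * b ^ 2 [ZMOD p] := by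
          obtain ⟨k, hk⟩ := hΔp.dvd
          obtain ⟨i, hi⟩ := hpc
          rw [Int.modEq_iff_dvd]
          exact ⟨-(k + 4 * a * i), by rw [hi] at hk; linear_combination -hk⟩
        rw [jacobiSym.mod_left' h1, jacobiSym.mul_left, sq b, jacobiSym.mul_left b, ← sq,
          jacobiSym.sq_one (Int.isCoprime_iff_gcd_eq_one.mp (hcop b hpb)), mul_one]
      have hm1 : ((jacobiSym (-1) p : ℤ) : ℂ) ^ 2 = 1 :=
        jacobiSym_sq_of_isCoprime (isCoprime_one_left.neg_left)
      rw [doubleGaussSum_prime_pow_of_dvd hp.ne_zero (hS.mul_left (hcop b hpb)) hpc, hJ]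
      have : (jacobiSym (-1) p : ℂ) ^ (n + α + 0) * (jacobiSym (-1) p : ℂ) ^ ((n + α) * (0 + 1))
          = 1 := by
        rw [← pow_add, show n + α + 0 + (n + α) * (0 + 1) = 2 * (n + α) by ring, pow_mul, hm1,
          one_pow]
      rw [mul_assoc (_ * _) (_ ^ (n + α + 0)), this]
      simp
  · rintro rfl hαn δ D hD hΔ
    have hodd : ∀ m : ℤ, ¬ (2 : ℤ) ∣ m → Odd m := fun m hm => by
      rw [← Int.not_even_iff_odd, even_iff_two_dvd]; exact hm
    have hSo : Odd S := hodd S fun h => hpZ.not_isUnit (hS.isUnit_of_dvd' h dvd_rfl)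
    have hAo := hodd A hA
    have hDo := hodd D hD
    rcases Int.even_or_odd b with hb2 | hb2
    · have h0 : α = 0 := by
        by_contra h0
        exact (hpos h0).2.2 hb2.two_dvd
      subst h0
      rw [pow_zero, one_mul] at ha
      rw [add_zero] at hΔ
      have := doubleGaussSum_two_pow_of_even (by omega) hSo hAo ha hb2 hDo hΔ
      simpa using this
    · have hδ0 : δ = 0 := by
        by_contra hδ0
        have h1 := (Int.ModEq.dvd_iff (hΔ.of_dvd (dvd_pow_self 2 (by omega)))).mpr
          ((dvd_pow_self (2 : ℤ) hδ0).mul_right D)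
        have h2 : (2 : ℤ) ∣ b ^ 2 := (dvd_sub_right ⟨2 * a * c, by ring⟩).mp h1
        exact Int.not_even_iff_odd.mpr hb2.pow (even_iff_two_dvd.mpr h2)
      subst hδ0
      refine ⟨fun h => by omega, fun h => by omega, fun _ => ?_⟩
      have h8 : 4 * a * c - b ^ 2 ≡ D [ZMOD 8] := by
        rw [pow_zero, one_mul] at hΔ
        refine hΔ.of_dvd ?_
        rw [show (8 : ℤ) = 2 ^ 3 by norm_num]
        exact pow_dvd_pow 2 (by omega)
      -- The formula carries exponent $n+\alpha$ on $(2/D)$; it differs from $n$ only if $\alpha>0$,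
      -- and then $c$ is even and $(2/D)=1$.
      rw [doubleGaussSum_two_pow_of_odd_middle (S * A) (l := n + α) hSo hb2 ?_ ?_ h8]
      · simp
      · rcases eq_or_ne α 0 with h0 | h0
        · exact Or.inl (hodd a (hzero h0))
        · exact Or.inr (even_iff_two_dvd.mpr (hpos h0).2.1)
      · rcases eq_or_ne α 0 with h0 | h0
        · exact Or.inl (by omega)
        · exact Or.inr (even_iff_two_dvd.mpr (hpos h0).2.1)
  · rintro rfl hαn
    have hodd : ∀ m : ℤ, ¬ (2 : ℤ) ∣ m → Odd m := fun m hm => by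
      rw [← Int.not_even_iff_odd, even_iff_two_dvd]; exact hm
    have hSo : Odd S := hodd S fun h => hpZ.not_isUnit (hS.isUnit_of_dvd' h dvd_rfl)
    have hbc : α ≠ 0 → doubleGaussSum a b c S (2 ^ n) = 2 ^ n := fun h0 => by
      obtain ⟨_, hpc, hpb⟩ := hpos h0
      exact_mod_cast doubleGaussSum_prime_pow_of_dvd two_ne_zero (hS.mul_left (hcop b hpb)) hpc n
    refine ⟨fun h1 => hbc (by omega), ?_⟩
    rintro rfl
    -- For $n=1$, $\alpha=0$ only $a$ is known to be odd, so the four terms of the sum are checked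
    -- for each parity of $b$ and $c$.
    rcases eq_or_ne α 0 with h0 | h0
    · have hao : Odd a := hodd a (hzero h0)
      rw [pow_one, doubleGaussSum_modulus_two, unitExp_two_of_odd (hSo.mul hao)]
      rcases Int.even_or_odd b with hb2 | hb2 <;> rcases Int.even_or_odd c with hc2 | hc2
      · rw [unitExp_two_of_even (hc2.mul_left S),
          unitExp_two_of_odd (hSo.mul ((hao.add_even hb2).add_even hc2)), hc2.neg_one_zpow,
          (hb2.add_odd odd_one).neg_one_zpow]
        norm_num
      · rw [unitExp_two_of_odd (hSo.mul hc2),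
          unitExp_two_of_even (((hao.add_even hb2).add_odd hc2).mul_left S), hc2.neg_one_zpow,
          (hb2.add_odd odd_one).neg_one_zpow]
        norm_num
      · rw [unitExp_two_of_even (hc2.mul_left S),
          unitExp_two_of_even ((Even.add (hao.add_odd hb2) hc2).mul_left S), hc2.neg_one_zpow,
          (hb2.add_odd odd_one).neg_one_zpow]
        norm_num
      · rw [unitExp_two_of_odd (hSo.mul hc2),
          unitExp_two_of_odd (hSo.mul ((hao.add_odd hb2).add_odd hc2)), hc2.neg_one_zpow,
          (hb2.add_odd odd_one).neg_one_zpow]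
        norm_num
    · obtain ⟨_, hpc, hpb⟩ := hpos h0
      rw [hbc h0, (even_iff_two_dvd.mpr hpc).neg_one_zpow,
        ((hodd b hpb).add_odd odd_one).neg_one_zpow]
      norm_num
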